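/- For each $n$ let $Y = X\beta^* + \epsilon$ with a deterministic design $X\in\mathbb R^{n\times p}$, $p=p_n$, coefficients $\beta^*=\beta^*_n\in\mathbb R^p$, $S=\{j:\beta^*_j\ne 0\}$, $s=s_n=|S|\ge 1$, and let $C_{11}=\frac1n X_S^TX_S$, $C_{21}=\frac1n X_{S^c}^TX_S$, where $X_T$ denotes the submatrix of the columns of $X$ with index in $T$. Write $a_n\propto b_n$ if $k b_n\le a_n\le K b_n$ for constants $k,K>0$ and all large $n$. Suppose that there are constants $\sigma,\Lambda_{\min},M,\eta>0$ and $c_1,c_2,c_3,c_4$ with $0\le c_1<1$, $0<c_2<1-c_1$, $c_1+c_2<c_3\le 1$, $c_2<c_4<c_3-c_1$, such that (the conditions at fixed $n$ being required for all large $n$): (a) $\epsilon_1,\dots,\epsilon_n$ are i.i.d. $N(0,\sigma^2)$; (b) $\frac1n\sum_i x_{ij}=0$ and $\frac1n\sum_i x_{ij}^2=1$ for $j=1,\dots,p$; (c) the smallest eigenvalue of $C_{11}$ is at least $\Lambda_{\min}$; (d) $s_n=O(n^{c_1})$ and $p_n=O(e^{n^{c_2}})$; (g) $\frac1n\|X\beta^*\|_2^2=O(n)$;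 (i) $n^{(1-c_3)/2}\min_{j\in S}|\beta^*_j|\ge M$; (j) $\lambda_n\propto n^{(1+c_4)/2}$; (Irrepresentable condition) $|C_{21}C_{11}^{-1}\mathrm{sign}(\beta^*_S)|\le 1-\eta$ componentwise; and that $\tau_n\propto \frac1n$ and $\mu_n\propto e^{-n^{c_2}/4}$. Let $\hat\beta$ be a (measurable) Lasso estimator, a minimizer of $\|Y-X\beta\|_2^2+\lambda_n\|\beta\|_1$, and $\hat S=\{j:\hat\beta_j\neq0\}$. Let $\tilde\beta$ be either - Lasso+mLS: $\tilde\beta_{\hat S^c}=0$ and $\tilde\beta_{\hat S}=\frac1{\sqrt n}VD_{\tau_n}^{-1}U^TY$, where $\frac1{\sqrt n}X_{\hat S}=UDV^T$ is a singular value decomposition (depending only on $X$ and $\hat S$) and $D_{\tau_n}^{-1}$ is the transpose of $D$ with every singular value $\lambda_k$ replaced by $\lambda_k^{-1}$ if $\lambda_k\ge\tau_n$ and by $0$ if $\lambda_k<\tau_n$; or - Lasso+Ridge: the minimizer of $\|Y-X\beta\|_2^2+\mu_n\|\beta\|_2^2$ over all $\beta$ with $\beta_{\hat S^c}=0$. Then,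 as $n\to\infty$, $\tilde\beta$ is square integrable for all large $n$ and $$\|E\tilde\beta-\beta^*\|_2^2=o\big(e^{-n^{c_2}/2}\big)\to0,\qquad E\|\tilde\beta-\beta^*\|_2^2=O\Big(\frac{\sigma^2}{\Lambda_{\min}}\frac sn\Big),$$ where the implied constant in the second bound is absolute: $E\|\tilde\beta-\beta^*\|_2^2\le K\frac{\sigma^2}{\Lambda_{\min}}\frac sn$ for all large $n$, with $K$ a universal constant. -/

import Mathlib

open Filter Topology Asymptotics MeasureTheory ProbabilityTheory
open scoped Matrix

noncomputable section

namespace PostLasso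

/-- `a_n ∝ b_n`: the two sequences are eventually equal up to positive constant factors. -/
def SameOrder (a b : ℕ → ℝ) : Prop :=
  ∃ k K : ℝ, 0 < k ∧ 0 < K ∧ ∀ᶠ n in atTop, k * b n ≤ a n ∧ a n ≤ K * b n

/-- The set of indices of the nonzero coordinates of `b`. -/
def supp {p : ℕ} (b : Fin p → ℝ) : Finset (Fin p) :=
  Finset.univ.filter fun j => b j ≠ 0

/-- The submatrix `X_T` of the columns of `X` with index in `T`. -/
def cols {n p : ℕ} (X : Matrix (Fin n) (Fin p) ℝ) (T : Finset (Fin p)) :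
    Matrix (Fin n) {j // j ∈ T} ℝ :=
  X.submatrix id Subtype.val

/-- The submatrix `X_{Tᶜ}` of the columns of `X` with index outside `T`. -/
def colsCompl {n p : ℕ} (X : Matrix (Fin n) (Fin p) ℝ) (T : Finset (Fin p)) :
    Matrix (Fin n) {j // j ∉ T} ℝ :=
  X.submatrix id Subtype.val

/-- `C₁₁ = (1/n) X_Sᵀ X_S`. -/
def C11 {n p : ℕ} (X : Matrix (Fin n) (Fin p) ℝ) (S : Finset (Fin p)) :
    Matrix {j // j ∈ S} {j // j ∈ S} ℝ :=
  (1 / (n : ℝ)) • ((cols X S)ᵀ * cols X S)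

/-- `C₂₁ = (1/n) X_{Sᶜ}ᵀ X_S`. -/
def C21 {n p : ℕ} (X : Matrix (Fin n) (Fin p) ℝ) (S : Finset (Fin p)) :
    Matrix {j // j ∉ S} {j // j ∈ S} ℝ :=
  (1 / (n : ℝ)) • ((colsCompl X S)ᵀ * cols X S)

/-- Residual sum of squares `‖y - X b‖₂²`. -/
def rss {n p : ℕ} (X : Matrix (Fin n) (Fin p) ℝ) (y : Fin n → ℝ) (b : Fin p → ℝ) : ℝ :=
  ∑ i, (y i - (X *ᵥ b) i) ^ 2

/-- `b` is a Lasso estimate: it minimizes `‖y - X b‖₂² + lam ‖b‖₁`. -/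
def IsLasso {n p : ℕ} (X : Matrix (Fin n) (Fin p) ℝ) (y : Fin n → ℝ) (lam : ℝ)
    (b : Fin p → ℝ) : Prop :=
  ∀ b' : Fin p → ℝ, rss X y b + lam * ∑ j, |b j| ≤ rss X y b' + lam * ∑ j, |b' j|

/-- `b` is a Ridge estimate on the selected set `T`: among the vectors that vanish outside `T`
it minimizes `‖y - X b‖₂² + mu ‖b‖₂²`. -/
def IsSelectRidge {n p : ℕ} (X : Matrix (Fin n) (Fin p) ℝ) (y : Fin n → ℝ) (mu : ℝ)
    (T : Finset (Fin p)) (b : Fin p → ℝ) : Prop :=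
  (∀ j, j ∉ T → b j = 0) ∧
    ∀ b' : Fin p → ℝ, (∀ j, j ∉ T → b' j = 0) →
      rss X y b + mu * ∑ j, b j ^ 2 ≤ rss X y b' + mu * ∑ j, b' j ^ 2

/-- The `m × d` matrix with `v` on its main diagonal and zeros elsewhere. -/
def rectDiag (m : ℕ) {d : ℕ} (v : Fin d → ℝ) : Matrix (Fin m) (Fin d) ℝ :=
  Matrix.of fun i k => if (i : ℕ) = (k : ℕ) then v k else 0

/-- A singular value decomposition `A = U D Vᵀ` of an `n × d` matrix, where `d` is the number
of elements of the type `ι` of column indices; `U` and `V` are orthogonal and `D` is diagonal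
with entries `sv 0 ≥ sv 1 ≥ … ≥ 0`. -/
structure SVD {n : ℕ} {ι : Type*} [Fintype ι] [DecidableEq ι] (A : Matrix (Fin n) ι ℝ) where
  U : Matrix (Fin n) (Fin n) ℝ
  V : Matrix ι (Fin (Fintype.card ι)) ℝ
  sv : Fin (Fintype.card ι) → ℝ
  U_left : Uᵀ * U = 1
  U_right : U * Uᵀ = 1
  V_left : Vᵀ * V = 1
  V_right : V * Vᵀ = 1
  sv_nonneg : ∀ k, 0 ≤ sv k
  sv_antitone : Antitone sv
  eq_mul : A = U * rectDiag n sv * Vᵀ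

/-- Every real matrix with rows indexed by `Fin n` has a singular value decomposition. -/
theorem SVD.nonempty {n : ℕ} {ι : Type*} [Fintype ι] [DecidableEq ι]
    (A : Matrix (Fin n) ι ℝ) : Nonempty (SVD A) := by
  classical
  have hpsd : (Aᵀ * A).PosSemidef := by
    simpa using Matrix.posSemidef_conjTranspose_mul_self A
  have hM : (Aᵀ * A).IsHermitian := hpsd.1
  let e : Fin (Fintype.card ι) ≃ ι := Fintype.equivOfCardEq (Fintype.card_fin _)
  let q := hM.eigenvectorBasis
  let V : Matrix ι (Fin (Fintype.card ι)) ℝ := Matrix.of fun i k => q (e k) i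
  have hcol : ∀ k, Vᵀ k = (q (e k)).ofLp := fun k => rfl
  have hev : ∀ k, hM.eigenvalues (e k) = hM.eigenvalues₀ k := by
    intro k
    simp [Matrix.IsHermitian.eigenvalues, e]
  have hev0 : ∀ k, 0 ≤ hM.eigenvalues₀ k := fun k => by
    rw [← hev]; exact hpsd.eigenvalues_nonneg _
  let sv : Fin (Fintype.card ι) → ℝ := fun k => √(hM.eigenvalues₀ k)
  have hsv2 : ∀ k, sv k * sv k = hM.eigenvalues₀ k := fun k => Real.mul_self_sqrt (hev0 k)
  have hVl : Vᵀ * V = 1 := by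
    ext k l
    have := orthonormal_iff_ite.1 q.orthonormal (e k) (e l)
    rw [PiLp.inner_apply] at this
    simp only [RCLike.inner_apply, conj_trivial, e.injective.eq_iff] at this
    rw [Matrix.mul_apply, Matrix.one_apply, ← this]
    exact Finset.sum_congr rfl fun i _ => mul_comm _ _
  have hVr : V * Vᵀ = 1 := by
    rw [Matrix.mul_eq_one_comm_of_card_eq _ _ _ (by simp)]
    exact hVl
  let w : Fin (Fintype.card ι) → EuclideanSpace ℝ (Fin n) := fun k => WithLp.toLp 2 (A *ᵥ Vᵀ k)
  have hw : ∀ k l, inner ℝ (w k) (w l) = if k = l then sv k * sv k else 0 := by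
    intro k l
    have h1 : inner ℝ (w k) (w l) = Vᵀ k ⬝ᵥ ((Aᵀ * A) *ᵥ Vᵀ l) := by
      rw [← Matrix.mulVec_mulVec, Matrix.dotProduct_mulVec, Matrix.vecMul_transpose]
      rw [PiLp.inner_apply]
      simp only [RCLike.inner_apply, conj_trivial, w, dotProduct]
      exact Finset.sum_congr rfl fun i _ => mul_comm _ _
    have h2 : (Aᵀ * A) *ᵥ Vᵀ l = hM.eigenvalues₀ l • Vᵀ l := by
      rw [hcol, hM.mulVec_eigenvectorBasis, hev]
    have h3 : Vᵀ k ⬝ᵥ Vᵀ l = if k = l then 1 else 0 := by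
      have := congrFun (congrFun hVl k) l
      rw [Matrix.one_apply] at this
      rw [← this]
      rfl
    rw [h1, h2, dotProduct_smul, h3]
    split_ifs with h
    · subst h; simp [hsv2]
    · simp
  have hw0 : ∀ k, sv k = 0 → w k = 0 := by
    intro k hk
    have := hw k k
    simpa [hk] using this
  have hanti : Antitone sv := fun k l h => Real.sqrt_le_sqrt (hM.eigenvalues₀_antitone h)
  have hon : Orthonormal ℝ fun k : {k // sv k ≠ 0} => (sv k)⁻¹ • w k := by
    rw [orthonormal_iff_ite]
    rintro ⟨k, hk⟩ ⟨l, hl⟩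
    rw [inner_smul_left, inner_smul_right, hw]
    by_cases h : k = l
    · subst h
      simp only [conj_trivial, if_true]
      field_simp
    · simp [h]
  have hlt : ∀ k, sv k ≠ 0 → (k : ℕ) < n := by
    intro k hk
    have hc := hon.linearIndependent.fintype_card_le_finrank
    rw [finrank_euclideanSpace_fin] at hc
    have hpos : ∀ l : Fin (k + 1), sv ⟨l, by omega⟩ ≠ 0 := by
      intro l
      have h1 : sv k ≤ sv ⟨l, by omega⟩ := hanti (by
        rw [Fin.le_def]; simp only; omega)
      have h2 : 0 < sv k := lt_of_le_of_ne (Real.sqrt_nonneg _) (Ne.symm hk)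
      exact (lt_of_lt_of_le h2 h1).ne'
    have hi := Fintype.card_le_of_injective
      (fun l : Fin (k + 1) => (⟨⟨l, by omega⟩, hpos l⟩ : {k // sv k ≠ 0})) (by
        intro a b hab
        simp only [Subtype.mk.injEq, Fin.mk.injEq] at hab
        exact Fin.ext hab)
    rw [Fintype.card_fin] at hi
    omega
  let v : Fin n → EuclideanSpace ℝ (Fin n) := fun i =>
    if h : (i : ℕ) < Fintype.card ι then (sv ⟨i, h⟩)⁻¹ • w ⟨i, h⟩ else 0
  let s : Set (Fin n) := {i | ∃ h : (i : ℕ) < Fintype.card ι, sv ⟨i, h⟩ ≠ 0}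
  have hv : Orthonormal ℝ (s.domRestrict v) := by
    let f : s → {k // sv k ≠ 0} := fun i => ⟨⟨i.1, i.2.choose⟩, i.2.choose_spec⟩
    have hf : Function.Injective f := by
      intro a b hab
      simp only [f, Subtype.mk.injEq, Fin.mk.injEq] at hab
      exact Subtype.ext (Fin.ext hab)
    have := hon.comp f hf
    convert this using 1
    funext i
    have hi : (i.1 : ℕ) < Fintype.card ι := i.2.choose
    simp [Set.domRestrict, v, f, hi]
  obtain ⟨b, hb⟩ := hv.exists_orthonormalBasis_extension_of_card_eq (by simp)
  let U : Matrix (Fin n) (Fin n) ℝ := Matrix.of fun i j => b j i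
  have hUl : Uᵀ * U = 1 := by
    ext k l
    have := orthonormal_iff_ite.1 b.orthonormal k l
    rw [PiLp.inner_apply] at this
    simp only [RCLike.inner_apply, conj_trivial] at this
    rw [Matrix.mul_apply, Matrix.one_apply, ← this]
    exact Finset.sum_congr rfl fun i _ => mul_comm _ _
  have hUr : U * Uᵀ = 1 := mul_eq_one_comm.1 hUl
  have hAV : A * V = U * rectDiag n sv := by
    ext i k
    have hl : (A * V) i k = w k i := rfl
    rw [hl, Matrix.mul_apply]
    by_cases hk : sv k = 0
    · rw [hw0 k hk]
      symm
      simp only [PiLp.zero_apply]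
      refine Finset.sum_eq_zero fun j _ => ?_
      simp [rectDiag, hk]
    · have hkn := hlt k hk
      rw [Finset.sum_eq_single ⟨k, hkn⟩]
      · have hbk : b ⟨k, hkn⟩ = (sv k)⁻¹ • w k := by
          rw [hb ⟨k, hkn⟩ ⟨k.2, hk⟩]
          simp [v]
        simp only [rectDiag, U, Matrix.of_apply, hbk, if_true, PiLp.smul_apply, smul_eq_mul]
        field_simp
      · intro j _ hj
        have : (j : ℕ) ≠ k := fun h => hj (Fin.ext h)
        simp [rectDiag, this]
      · simp
  exact ⟨⟨U, V, sv, hUl, hUr, hVl, hVr, fun k => Real.sqrt_nonneg _, hanti, by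
    rw [← hAV, Matrix.mul_assoc, hVr, Matrix.mul_one]⟩⟩

/-- Inverse with hard thresholding: `x⁻¹` if `x ≥ tau`, and `0` if `x < tau`. -/
def thresholdInv (tau x : ℝ) : ℝ := if x < tau then 0 else x⁻¹

/-- The modified least squares coefficients `(1/√n) V D⁻¹ Uᵀ y` of the regression of `y` on the
columns `T` of `X`, computed from a singular value decomposition of `(1/√n) X_T`, where
the reciprocals of the singular values below `tau` are replaced by `0`. -/
def mLS {n p : ℕ} (X : Matrix (Fin n) (Fin p) ℝ) (T : Finset (Fin p))
    (W : SVD ((1 / √(n : ℝ)) • cols X T)) (tau : ℝ) (y : Fin n → ℝ) : {j // j ∈ T} → ℝ :=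
  (1 / √(n : ℝ)) • ((W.V * (rectDiag n fun k => thresholdInv tau (W.sv k))ᵀ * W.Uᵀ) *ᵥ y)

/-- Modified least squares after selection of `T`: the modified least squares coefficients on
`T` and zero outside `T`. -/
def selectMLS {n p : ℕ} (X : Matrix (Fin n) (Fin p) ℝ) (T : Finset (Fin p))
    (W : SVD ((1 / √(n : ℝ)) • cols X T)) (tau : ℝ) (y : Fin n → ℝ) :
    EuclideanSpace ℝ (Fin p) :=
  WithLp.toLp 2 fun j => if h : j ∈ T then mLS X T W tau y ⟨j, h⟩ else 0

/-- The response `Y = X β + ε`. -/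
def response {n p : ℕ} {Ω : Type*} (X : Matrix (Fin n) (Fin p) ℝ)
    (b : EuclideanSpace ℝ (Fin p)) (e : Fin n → Ω → ℝ) (ω : Ω) : Fin n → ℝ :=
  fun i => (X *ᵥ b.ofLp) i + e i ω

/-- The claimed bias and mean squared error rates for a sequence of estimators `bt n` of
`bs n`: eventually square integrable, squared bias `o(e^{-n^{c₂}/2})`, tending to zero, and mean
squared error at most `K (σ²/Λ) (s/n)` for all large `n`, with `s` the number of
nonzero coordinates of `bs n`. -/
def HasRates {Ω : ℕ → Type*} [∀ n, MeasurableSpace (Ω n)] (P : ∀ n, Measure (Ω n)) {p : ℕ → ℕ}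
    (bs : ∀ n, EuclideanSpace ℝ (Fin (p n))) (bt : ∀ n, Ω n → EuclideanSpace ℝ (Fin (p n)))
    (c₂ σ Λ K : ℝ) : Prop :=
  (∀ᶠ n in atTop, MemLp (bt n) 2 (P n)) ∧
  (fun n : ℕ => ‖(∫ ω, bt n ω ∂(P n)) - bs n‖ ^ 2)
    =o[atTop] (fun n : ℕ => Real.exp (-(n : ℝ) ^ c₂ / 2)) ∧
  Tendsto (fun n : ℕ => ‖(∫ ω, bt n ω ∂(P n)) - bs n‖ ^ 2) atTop (𝓝 0) ∧
  ∀ᶠ n : ℕ in atTop, ∫ ω, ‖bt n ω - bs n‖ ^ 2 ∂(P n)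
    ≤ K * (σ ^ 2 / Λ * (((supp (bs n).ofLp).card : ℝ) / n))

end PostLasso

end

/-! On a fixed column set both second-stage estimators are linear in `Y`: with `A = X_T / √n = U D
Vᵀ` they are `(1/√n) V g(D)ᵀ Uᵀ Y`, where `g` is the thresholded inverse for mLS and `d ↦ d / (d² +
μ/n)` for Ridge. On the true support every singular value satisfies `d² ≥ Λ`. Hence `g(d)² ≤ 1/Λ`,
which gives variance at most `σ² s / (n Λ)`. The squared bias is at most `sup (1 - g(d) d)² ‖β*‖²`:
eventually zero for mLS, negligible for Ridge because `‖β*‖² = O(n)` (`ridge_bias_isLittleO`).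

It remains to pay for a wrong selection. The strict Karush-Kuhn-Tucker conditions reduce exact
support recovery to finitely many linear forms of the Gaussian noise being small (`supp_lasso_eq`).
A union bound then makes the failure probability at most `a exp(n^c₂ - κ n^c₄)` with `c₂ < c₄`
(`exists_selection_rate`). On the failure event the error is bounded crudely, over all column sets
at once, by a Frobenius norm of order `n² exp(2 n^c₂)` times `‖Y‖²`, whose second moment is
polynomial in `n`. The factor `exp(-κ n^c₄ / 2)` left after a Cauchy-Schwarz type splitting beats
all of this (`integral_select_sub_sq_le`, `selection_error_isLittleO`), and `hasRates_of_select`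
combines the pieces. -/

noncomputable section

namespace PostLasso

/-! ### Spectral filters of a singular value decomposition. -/

section SpectralFilter

/-- With more columns than rows, the entries with index at least `n` have no place in the `n × d`
matrix. The decomposition says nothing about such singular values, so the condition `k < n` is
carried along. -/
theorem rectDiag_transpose_mul (n : ℕ) {d : ℕ} (u v : Fin d → ℝ) :
    (rectDiag n u)ᵀ * rectDiag n v =
      Matrix.diagonal fun k : Fin d => if (k : ℕ) < n then u k * v k else 0 := by
  ext k l
  rw [Matrix.mul_apply, Matrix.diagonal_apply]
  simp only [rectDiag, Matrix.transpose_apply, Matrix.of_apply]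
  by_cases hk : (k : ℕ) < n
  · rw [Finset.sum_eq_single ⟨k, hk⟩]
    · by_cases hkl : k = l
      · subst hkl; simp [hk]
      · have : (k : ℕ) ≠ l := fun h => hkl (Fin.ext h)
        simp [this, hkl]
    · intro i _ hi
      have : (i : ℕ) ≠ k := fun h => hi (Fin.ext h)
      simp [this]
    · simp
  · rw [Finset.sum_eq_zero]
    · simp [hk]
    · intro i _
      have : (i : ℕ) ≠ k := by have := i.2; omega
      simp [this]

variable {n : ℕ} {ι : Type*} [Fintype ι] [DecidableEq ι] {A : Matrix (Fin n) ι ℝ}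

/-- The spectral filter `V g(D)ᵀ Uᵀ` of a matrix with singular value decomposition `U D Vᵀ`. -/
def SVD.filter (W : SVD A) (g : ℝ → ℝ) : Matrix ι (Fin n) ℝ :=
  W.V * (rectDiag n fun k => g (W.sv k))ᵀ * W.Uᵀ

theorem SVD.transpose_mul_self (W : SVD A) :
    Aᵀ * A = W.V * Matrix.diagonal (fun k : Fin (Fintype.card ι) => if (k : ℕ) < n then W.sv k * W.sv k else 0) *
      W.Vᵀ := by
  conv_lhs => rw [W.eq_mul]
  rw [← rectDiag_transpose_mul]
  simp only [Matrix.transpose_mul, Matrix.transpose_transpose, Matrix.mul_assoc]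
  rw [← Matrix.mul_assoc W.Uᵀ, W.U_left, Matrix.one_mul]

theorem SVD.filter_mul_self (W : SVD A) (g : ℝ → ℝ) :
    W.filter g * A =
      W.V * Matrix.diagonal (fun k : Fin (Fintype.card ι) => if (k : ℕ) < n then g (W.sv k) * W.sv k else 0) * W.Vᵀ := by
  refine (congrArg (W.filter g * ·) W.eq_mul).trans ?_
  rw [← rectDiag_transpose_mul]
  simp only [SVD.filter, Matrix.mul_assoc]
  rw [← Matrix.mul_assoc W.Uᵀ, W.U_left, Matrix.one_mul]

theorem SVD.filter_mul_transpose (W : SVD A) (g : ℝ → ℝ) :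
    W.filter g * (W.filter g)ᵀ =
      W.V * Matrix.diagonal (fun k : Fin (Fintype.card ι) => if (k : ℕ) < n then g (W.sv k) * g (W.sv k) else 0) *
        W.Vᵀ := by
  rw [← rectDiag_transpose_mul]
  simp only [SVD.filter, Matrix.transpose_mul, Matrix.transpose_transpose, Matrix.mul_assoc]
  rw [← Matrix.mul_assoc W.Uᵀ, W.U_left, Matrix.one_mul]

/-- The squared Frobenius norm is a trace, unchanged by orthogonal factors. It serves both as the
variance of the filtered noise and as the worst-case gain of the estimator. -/
theorem SVD.sum_sq_filter (W : SVD A) (g : ℝ → ℝ) :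
    ∑ a, ∑ i, W.filter g a i ^ 2 = ∑ k : Fin (Fintype.card ι), if (k : ℕ) < n then g (W.sv k) ^ 2 else 0 := by
  have h1 : ∑ a, ∑ i, W.filter g a i ^ 2 = (W.filter g * (W.filter g)ᵀ).trace := by
    simp [Matrix.trace, Matrix.mul_apply, sq]
  rw [h1, W.filter_mul_transpose, Matrix.trace_mul_comm, ← Matrix.mul_assoc, W.V_left,
    Matrix.one_mul, Matrix.trace_diagonal]
  simp [sq]

/-- The filter `d ↦ d / (d² + ν)` solves the regularized normal equations. -/
theorem SVD.ridge_filter (W : SVD A) {ν : ℝ} (hν : 0 < ν) :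
    Aᵀ * A * W.filter (fun d => d / (d ^ 2 + ν)) + ν • W.filter (fun d => d / (d ^ 2 + ν)) =
      Aᵀ := by
  set g : ℝ → ℝ := fun d => d / (d ^ 2 + ν)
  have hg : ∀ d, d * d * g d + ν * g d = d := by
    intro d
    have : d ^ 2 + ν ≠ 0 := by positivity
    simp only [g]
    field_simp
  have h1 : Aᵀ * A * W.filter g = W.V * (Matrix.diagonal
      (fun k : Fin (Fintype.card ι) => if (k : ℕ) < n then W.sv k * W.sv k else 0) *
        (rectDiag n fun k => g (W.sv k))ᵀ) * W.Uᵀ := by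
    rw [W.transpose_mul_self]
    simp only [SVD.filter, Matrix.mul_assoc]
    rw [← Matrix.mul_assoc W.Vᵀ, W.V_left, Matrix.one_mul]
  have h2 : Aᵀ = W.V * (rectDiag n W.sv)ᵀ * W.Uᵀ := by
    conv_lhs => rw [W.eq_mul]
    simp [Matrix.transpose_mul, Matrix.mul_assoc]
  rw [h1]
  conv_rhs => rw [h2]
  rw [SVD.filter, ← Matrix.smul_mul, ← Matrix.mul_smul, ← Matrix.add_mul, ← Matrix.mul_add]
  congr 2
  ext k i
  rw [Matrix.add_apply, Matrix.diagonal_mul]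
  simp only [Matrix.smul_apply, Matrix.transpose_apply, rectDiag, Matrix.of_apply, smul_eq_mul]
  by_cases h : (i : ℕ) = k
  · have hk : (k : ℕ) < n := h ▸ i.2
    simp [h, hk, hg]
  · simp [h]

theorem SVD.sum_sq_transpose_V (W : SVD A) (b : ι → ℝ) :
    ∑ k, (W.Vᵀ *ᵥ b) k ^ 2 = ∑ a, b a ^ 2 := by
  have h : (W.Vᵀ *ᵥ b) ⬝ᵥ (W.Vᵀ *ᵥ b) = b ⬝ᵥ b := by
    rw [Matrix.dotProduct_mulVec, Matrix.vecMul_transpose, Matrix.mulVec_mulVec, W.V_right,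
      Matrix.one_mulVec]
  simpa [dotProduct, sq] using h

theorem SVD.sum_sq_V (W : SVD A) (z : Fin (Fintype.card ι) → ℝ) :
    ∑ a, (W.V *ᵥ z) a ^ 2 = ∑ k, z k ^ 2 := by
  have h : (W.V *ᵥ z) ⬝ᵥ (W.V *ᵥ z) = z ⬝ᵥ z := by
    rw [Matrix.dotProduct_mulVec, Matrix.vecMul_mulVec, W.V_left, Matrix.vecMul_one]
  simpa [dotProduct, sq] using h

/-- If the Gram matrix is bounded below, so are the squared singular values, and there are at
most `n` of them. -/
theorem SVD.le_sv_sq (W : SVD A) {Λ : ℝ} (hΛ : 0 < Λ)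
    (h : ∀ v : ι → ℝ, Λ * ∑ a, v a ^ 2 ≤ v ⬝ᵥ ((Aᵀ * A) *ᵥ v)) (k : Fin (Fintype.card ι)) :
    (k : ℕ) < n ∧ Λ ≤ W.sv k ^ 2 := by
  -- Test the Gram form on the `k`-th right singular vector; for `k ≥ n` the form would vanish
  -- there, against `Λ > 0`.
  have h1 := h (W.V *ᵥ Pi.single k 1)
  rw [W.sum_sq_V] at h1
  have h2 : (W.V *ᵥ Pi.single k 1) ⬝ᵥ ((Aᵀ * A) *ᵥ (W.V *ᵥ Pi.single k 1)) =
      if (k : ℕ) < n then W.sv k ^ 2 else 0 := by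
    rw [W.transpose_mul_self, Matrix.mulVec_mulVec, Matrix.mul_assoc, W.V_left, Matrix.mul_one,
      ← Matrix.mulVec_mulVec, Matrix.dotProduct_mulVec, Matrix.vecMul_mulVec, W.V_left,
      Matrix.vecMul_one]
    simp [sq]
  have h3 : ∑ l, (Pi.single k (1 : ℝ) : Fin (Fintype.card ι) → ℝ) l ^ 2 = 1 := by
    simp [Pi.single_apply]
  rw [h2, h3] at h1
  split_ifs at h1 with hk
  · exact ⟨hk, by linarith⟩
  · linarith

/-- The error of a spectral filter as an approximate left inverse. -/
theorem SVD.sum_sq_filter_mul_sub_le (W : SVD A) {Λ : ℝ} (hΛ : 0 < Λ)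
    (h : ∀ v : ι → ℝ, Λ * ∑ a, v a ^ 2 ≤ v ⬝ᵥ ((Aᵀ * A) *ᵥ v)) (g : ℝ → ℝ) {c : ℝ}
    (hg : ∀ d, 0 ≤ d → Λ ≤ d ^ 2 → (1 - g d * d) ^ 2 ≤ c) (b : ι → ℝ) :
    ∑ a, (((W.filter g * A) *ᵥ b) a - b a) ^ 2 ≤ c * ∑ a, b a ^ 2 := by
  -- In the basis of right singular vectors the error operator is diagonal with entries `g(d) d -
  -- 1`.
  have h1 : (W.filter g * A) *ᵥ b - b =
      W.V *ᵥ fun k => (g (W.sv k) * W.sv k - 1) * (W.Vᵀ *ᵥ b) k := by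
    have hb : b = W.V *ᵥ (W.Vᵀ *ᵥ b) := by rw [Matrix.mulVec_mulVec, W.V_right, Matrix.one_mulVec]
    conv_lhs => rw [W.filter_mul_self]; arg 2; rw [hb]
    rw [← Matrix.mulVec_mulVec, ← Matrix.mulVec_mulVec, ← Matrix.mulVec_sub]
    congr 1
    ext k
    rw [Pi.sub_apply, Matrix.mulVec_diagonal, if_pos (W.le_sv_sq hΛ h k).1,
      sub_mul, one_mul]
  calc ∑ a, (((W.filter g * A) *ᵥ b) a - b a) ^ 2
      = ∑ a, ((W.filter g * A) *ᵥ b - b) a ^ 2 := rfl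
    _ = ∑ k, ((g (W.sv k) * W.sv k - 1) * (W.Vᵀ *ᵥ b) k) ^ 2 := by rw [h1, W.sum_sq_V]
    _ ≤ ∑ k, c * (W.Vᵀ *ᵥ b) k ^ 2 := by
        refine Finset.sum_le_sum fun k _ => ?_
        rw [mul_pow]
        refine mul_le_mul_of_nonneg_right ?_ (sq_nonneg _)
        have := hg _ (W.sv_nonneg k) (W.le_sv_sq hΛ h k).2
        nlinarith
    _ = c * ∑ a, b a ^ 2 := by rw [← Finset.mul_sum, W.sum_sq_transpose_V]

end SpectralFilter

/-! ### Second-stage estimators on a selected column set as spectral filters. -/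

section Select

variable {n p : ℕ} (X : Matrix (Fin n) (Fin p) ℝ) (T : Finset (Fin p))

/-- The linear map computing the coefficients obtained by applying a spectral filter to the
columns `T` of `X`, extended by zero. -/
def filterMatrix (W : SVD ((1 / √(n : ℝ)) • cols X T)) (g : ℝ → ℝ) :
    Matrix (Fin p) (Fin n) ℝ :=
  Matrix.of fun j i => if h : j ∈ T then (1 / √(n : ℝ)) * W.filter g ⟨j, h⟩ i else 0


variable {T}

theorem sum_dite_mem {α : Type*} [AddCommMonoid α] (f : {j // j ∈ T} → α) :
    (∑ j, if h : j ∈ T then f ⟨j, h⟩ else 0) = ∑ j, f j := by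
  rw [← Finset.sum_subset (Finset.subset_univ T) (fun j _ h => by simp [h]), ← Finset.sum_attach]
  exact Finset.sum_congr rfl fun j _ => by simp

theorem sum_eq_sum_subtype {α : Type*} [AddCommMonoid α] (f : Fin p → α)
    (hf : ∀ j, j ∉ T → f j = 0) : ∑ j, f j = ∑ j : {j // j ∈ T}, f j := by
  rw [← sum_dite_mem]
  refine Finset.sum_congr rfl fun j _ => ?_
  by_cases h : j ∈ T <;> simp [h, hf]

variable {X}

theorem cols_mulVec {b : Fin p → ℝ} (hb : ∀ j, j ∉ T → b j = 0) :
    cols X T *ᵥ (fun j : {j // j ∈ T} => b j) = X *ᵥ b := by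
  ext i
  simp only [Matrix.mulVec, dotProduct]
  rw [sum_eq_sum_subtype (T := T)]
  · rfl
  · intro j hj; simp [hb j hj]

theorem filterMatrix_mulVec (W : SVD ((1 / √(n : ℝ)) • cols X T)) (g : ℝ → ℝ) (y : Fin n → ℝ)
    (j : Fin p) : (filterMatrix X T W g *ᵥ y) j =
      if h : j ∈ T then (1 / √(n : ℝ)) * (W.filter g *ᵥ y) ⟨j, h⟩ else 0 := by
  by_cases h : j ∈ T
  · simp [filterMatrix, Matrix.mulVec, dotProduct, h, Finset.mul_sum, mul_assoc]
  · simp [filterMatrix, Matrix.mulVec, dotProduct, h]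

theorem selectMLS_eq (W : SVD ((1 / √(n : ℝ)) • cols X T)) (tau : ℝ) (y : Fin n → ℝ) :
    selectMLS X T W tau y = WithLp.toLp 2 (filterMatrix X T W (thresholdInv tau) *ᵥ y) := by
  ext j
  simp [selectMLS, filterMatrix_mulVec, mLS, SVD.filter]

theorem sum_sq_filterMatrix (W : SVD ((1 / √(n : ℝ)) • cols X T)) (g : ℝ → ℝ) :
    ∑ j, ∑ i, filterMatrix X T W g j i ^ 2 =
      1 / n * ∑ k : Fin (Fintype.card {j // j ∈ T}),
        if (k : ℕ) < n then g (W.sv k) ^ 2 else 0 := by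
  rw [← W.sum_sq_filter, sum_eq_sum_subtype (T := T), Finset.mul_sum]
  · refine Finset.sum_congr rfl fun j _ => ?_
    rw [Finset.mul_sum]
    refine Finset.sum_congr rfl fun i _ => ?_
    simp [filterMatrix, mul_pow]
  · intro j hj
    simp [filterMatrix, hj]

theorem sum_sq_filterMatrix_le (W : SVD ((1 / √(n : ℝ)) • cols X T)) (g : ℝ → ℝ) {G : ℝ}
    (hG : ∀ k, g (W.sv k) ^ 2 ≤ G) :
    ∑ j, ∑ i, filterMatrix X T W g j i ^ 2 ≤ 1 / n * (T.card * G) := by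
  rw [sum_sq_filterMatrix]
  refine mul_le_mul_of_nonneg_left ?_ (by positivity)
  calc _ ≤ ∑ k : Fin (Fintype.card {j // j ∈ T}), G := Finset.sum_le_sum fun k _ => by
        have := hG k
        split_ifs
        · exact this
        · exact (sq_nonneg _).trans this
    _ = T.card * G := by simp

theorem C11_eq : C11 X T = ((1 / √(n : ℝ)) • cols X T)ᵀ * ((1 / √(n : ℝ)) • cols X T) := by
  rw [C11, Matrix.transpose_smul, Matrix.smul_mul, Matrix.mul_smul, smul_smul]
  congr 1
  rw [div_mul_div_comm, one_mul, Real.mul_self_sqrt (by positivity)]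

theorem sum_sq_filterMatrix_sub_le (hn : 0 < n) (W : SVD ((1 / √(n : ℝ)) • cols X T)) {Λ : ℝ}
    (hΛ : 0 < Λ) (h : ∀ v : {j // j ∈ T} → ℝ, Λ * ∑ a, v a ^ 2 ≤ v ⬝ᵥ (C11 X T *ᵥ v))
    (g : ℝ → ℝ) {c : ℝ} (hg : ∀ d, 0 ≤ d → Λ ≤ d ^ 2 → (1 - g d * d) ^ 2 ≤ c) {b : Fin p → ℝ}
    (hb : ∀ j, j ∉ T → b j = 0) :
    ∑ j, ((filterMatrix X T W g *ᵥ (X *ᵥ b)) j - b j) ^ 2 ≤ c * ∑ j, b j ^ 2 := by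
  have hn' : √(n : ℝ) ≠ 0 := by positivity
  rw [C11_eq] at h
  have key := W.sum_sq_filter_mul_sub_le hΛ h g hg (fun j => b j)
  rw [sum_eq_sum_subtype (T := T), sum_eq_sum_subtype (T := T) fun j => b j ^ 2]
  · convert key using 4 with j
    rw [filterMatrix_mulVec, ← cols_mulVec hb, ← Matrix.mulVec_mulVec, Matrix.smul_mulVec,
      Matrix.mulVec_smul]
    simp
  · intro j hj; simp [hb j hj]
  · intro j hj; simp [filterMatrix_mulVec, hb j hj, hj]

/-- Exact second-order expansion of the quadratic loss; uniqueness for both Ridge and Lasso rests on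
it. -/
theorem rss_add (y : Fin n → ℝ) (b d : Fin p → ℝ) :
    rss X y (b + d) = rss X y b - 2 * ∑ j, (Xᵀ *ᵥ (y - X *ᵥ b)) j * d j +
      ∑ i, (X *ᵥ d) i ^ 2 := by
  have h : ∑ j, (Xᵀ *ᵥ (y - X *ᵥ b)) j * d j = (y - X *ᵥ b) ⬝ᵥ (X *ᵥ d) := by
    rw [Matrix.dotProduct_mulVec, ← Matrix.mulVec_transpose]; rfl
  rw [h, rss, rss, Matrix.mulVec_add, dotProduct, Finset.mul_sum, ← Finset.sum_sub_distrib,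
    ← Finset.sum_add_distrib]
  refine Finset.sum_congr rfl fun i _ => ?_
  simp only [Pi.add_apply, Pi.sub_apply]
  ring

/-- The Ridge objective is strictly convex around a solution of the normal equations. -/
theorem ridge_unique {y : Fin n → ℝ} {mu : ℝ} (hmu : 0 < mu) {b b' : Fin p → ℝ}
    (hb : ∀ j, j ∉ T → b j = 0) (hT : IsSelectRidge X y mu T b')
    (hN : ∀ j ∈ T, (Xᵀ *ᵥ (y - X *ᵥ b)) j = mu * b j) : b' = b := by
  set d := b' - b with hd
  have hb' : b' = b + d := by simp [hd]
  have h1 := rss_add (X := X) y b d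
  rw [← hb'] at h1
  have h2 : ∑ j, (Xᵀ *ᵥ (y - X *ᵥ b)) j * d j = ∑ j, mu * b j * d j := by
    refine Finset.sum_congr rfl fun j _ => ?_
    by_cases hj : j ∈ T
    · rw [hN j hj]
    · simp [hd, hb j hj, hT.1 j hj]
  have h3 : mu * ∑ j, b' j ^ 2 = mu * ∑ j, b j ^ 2 + 2 * ∑ j, mu * b j * d j +
      mu * ∑ j, d j ^ 2 := by
    simp only [Finset.mul_sum]
    rw [← Finset.sum_add_distrib, ← Finset.sum_add_distrib]
    refine Finset.sum_congr rfl fun j _ => ?_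
    rw [hb', Pi.add_apply]; ring
  have h4 := hT.2 b hb
  have h5 : 0 ≤ ∑ i, (X *ᵥ d) i ^ 2 := Finset.sum_nonneg fun i _ => sq_nonneg _
  -- The normal equations cancel the first-order terms, so minimality leaves `‖X d‖² + mu ‖d‖² ≤ 0`.
  have h6 : ∑ j, d j ^ 2 ≤ 0 := by
    have : mu * ∑ j, d j ^ 2 ≤ 0 := by linarith
    exact nonpos_of_mul_nonpos_right this hmu
  have h7 := (Finset.sum_eq_zero_iff_of_nonneg fun j _ => sq_nonneg (d j)).1
    (le_antisymm h6 (Finset.sum_nonneg fun j _ => sq_nonneg _))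
  rw [hb']
  ext j
  have := h7 j (Finset.mem_univ j)
  simp only [Pi.add_apply]
  nlinarith [pow_eq_zero_iff (two_ne_zero) |>.1 this]

/-- Dividing the Ridge normal equations by `n` turns them into those of `X_T / √n` with penalty `mu
/ n`, which `SVD.ridge_filter` solves. -/
theorem selectRidge_eq (hn : 0 < n) (W : SVD ((1 / √(n : ℝ)) • cols X T)) {y : Fin n → ℝ}
    {mu : ℝ} (hmu : 0 < mu) {b : Fin p → ℝ} (hb : IsSelectRidge X y mu T b) :
    b = filterMatrix X T W (fun d => d / (d ^ 2 + mu / n)) *ᵥ y := by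
  have hn' : (0 : ℝ) < n := by exact_mod_cast hn
  have hs : √(n : ℝ) ≠ 0 := by positivity
  set g : ℝ → ℝ := fun d => d / (d ^ 2 + mu / n) with hg
  have h0 : ∀ j, j ∉ T → (filterMatrix X T W g *ᵥ y) j = 0 := by
    intro j hj; simp [filterMatrix_mulVec, hj]
  refine ridge_unique hmu h0 hb fun j hj => ?_
  have hr : (fun j : {j // j ∈ T} => (filterMatrix X T W g *ᵥ y) j) =
      (1 / √(n : ℝ)) • (W.filter g *ᵥ y) := by
    ext j; simp [filterMatrix_mulVec]
  have h1 : (Xᵀ *ᵥ (y - X *ᵥ (filterMatrix X T W g *ᵥ y))) j =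
      ((cols X T)ᵀ *ᵥ (y - cols X T *ᵥ ((1 / √(n : ℝ)) • (W.filter g *ᵥ y)))) ⟨j, hj⟩ := by
    rw [← hr, cols_mulVec h0]; rfl
  have h2 := congrFun (congrArg (fun M => M *ᵥ y)
    (W.ridge_filter (ν := mu / n) (by positivity))) ⟨j, hj⟩
  simp only [Matrix.add_mulVec, Matrix.transpose_smul, Matrix.smul_mul, Matrix.mul_smul,
    Matrix.smul_mulVec, Pi.add_apply, Pi.smul_apply, smul_eq_mul, ← Matrix.mulVec_mulVec,
    ← hg] at h2
  rw [h1, filterMatrix_mulVec, dif_pos hj, Matrix.mulVec_sub, Matrix.mulVec_smul,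
    Matrix.mulVec_smul]
  simp only [Pi.sub_apply, Pi.smul_apply, smul_eq_mul]
  have hsq : √(n : ℝ) * √(n : ℝ) = n := Real.mul_self_sqrt hn'.le
  generalize ((cols X T)ᵀ *ᵥ y) ⟨j, hj⟩ = u at *
  generalize ((cols X T)ᵀ *ᵥ cols X T *ᵥ W.filter g *ᵥ y) ⟨j, hj⟩ = v at *
  generalize (W.filter g *ᵥ y) ⟨j, hj⟩ = w at *
  have h3 : 1 / √(n : ℝ) * (1 / √(n : ℝ)) = 1 / n := by rw [div_mul_div_comm, hsq, one_mul]
  have h4 : u = 1 / √(n : ℝ) * (v + mu * w) := by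
    have : √(n : ℝ) * (1 / √(n : ℝ) * u) = u := by field_simp
    rw [← this, ← h2, div_eq_mul_one_div mu, ← h3]
    field_simp
  rw [h4]; ring

end Select

/-! ### Consequences of a lower bound on the quadratic form of a matrix. -/

section Coercive

theorem sum_sq_eq_zero {ι : Type*} [Fintype ι] {v : ι → ℝ} (h : ∑ a, v a ^ 2 ≤ 0) : v = 0 := by
  have h1 := (Finset.sum_eq_zero_iff_of_nonneg fun a _ => sq_nonneg (v a)).1
    (le_antisymm h (Finset.sum_nonneg fun a _ => sq_nonneg _))
  ext a
  exact (pow_eq_zero_iff two_ne_zero).1 (h1 a (Finset.mem_univ a))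

variable {ι : Type*} [Fintype ι] [DecidableEq ι] {C : Matrix ι ι ℝ} {Λ : ℝ}

/-- `C - Λ I` is Hermitian with nonnegative spectrum. The quadratic-form version of the eigenvalue
condition is the one used from here on. -/
theorem coercive_of_spectrum (hC : C.IsHermitian) (h : ∀ t ∈ spectrum ℝ C, Λ ≤ t) (v : ι → ℝ) :
    Λ * ∑ a, v a ^ 2 ≤ v ⬝ᵥ (C *ᵥ v) := by
  have h1 : (C - algebraMap ℝ (Matrix ι ι ℝ) Λ).PosSemidef := by
    rw [Matrix.posSemidef_iff_isHermitian_and_spectrum_nonneg]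
    refine ⟨hC.sub ?_, ?_⟩
    · rw [Matrix.algebraMap_eq_diagonal]
      exact Matrix.isHermitian_diagonal _
    · rw [← spectrum.sub_singleton_eq]
      rintro t ht
      obtain ⟨u, hu, w, hw, rfl⟩ := Set.mem_sub.1 ht
      rw [Set.mem_singleton_iff.1 hw]
      exact sub_nonneg.2 (h u hu)
  have h2 := h1.dotProduct_mulVec_nonneg v
  rw [Matrix.sub_mulVec, dotProduct_sub, Algebra.algebraMap_eq_smul_one, Matrix.smul_mulVec,
    Matrix.one_mulVec, dotProduct_smul] at h2
  have h3 : v ⬝ᵥ v = ∑ a, v a ^ 2 := by simp [dotProduct, sq]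
  simp only [star_trivial, h3, smul_eq_mul] at h2
  linarith

theorem isUnit_of_coercive (hΛ : 0 < Λ) (h : ∀ v : ι → ℝ, Λ * ∑ a, v a ^ 2 ≤ v ⬝ᵥ (C *ᵥ v)) :
    IsUnit C := by
  rw [← Matrix.mulVec_injective_iff_isUnit]
  intro u v huv
  have h1 := h (u - v)
  have huv' : C *ᵥ u = C *ᵥ v := huv
  rw [Matrix.mulVec_sub, huv', sub_self, dotProduct_zero] at h1
  exact sub_eq_zero.1 (sum_sq_eq_zero (nonpos_of_mul_nonpos_right h1 hΛ))

theorem mul_inv_mulVec (hΛ : 0 < Λ) (h : ∀ v : ι → ℝ, Λ * ∑ a, v a ^ 2 ≤ v ⬝ᵥ (C *ᵥ v))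
    (u : ι → ℝ) : C *ᵥ (C⁻¹ *ᵥ u) = u := by
  rw [Matrix.mulVec_mulVec, Matrix.mul_nonsing_inv _
    ((Matrix.isUnit_iff_isUnit_det _).1 (isUnit_of_coercive hΛ h)), Matrix.one_mulVec]

/-- For `w = C⁻¹ u`, coercivity and `2ab ≤ a² + b²` give `2 Λ² ‖w‖² ≤ 2 Λ ⟨w, u⟩ ≤ Λ² ‖w‖² + ‖u‖²`.
-/
theorem sum_sq_inv_mulVec_le (hΛ : 0 < Λ) (h : ∀ v : ι → ℝ, Λ * ∑ a, v a ^ 2 ≤ v ⬝ᵥ (C *ᵥ v))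
    (u : ι → ℝ) : Λ ^ 2 * ∑ a, (C⁻¹ *ᵥ u) a ^ 2 ≤ ∑ a, u a ^ 2 := by
  have h1 := h (C⁻¹ *ᵥ u)
  rw [mul_inv_mulVec hΛ h] at h1
  have h2 : 2 * Λ * ((C⁻¹ *ᵥ u) ⬝ᵥ u) ≤ Λ ^ 2 * ∑ a, (C⁻¹ *ᵥ u) a ^ 2 + ∑ a, u a ^ 2 := by
    rw [dotProduct, Finset.mul_sum, Finset.mul_sum, ← Finset.sum_add_distrib]
    refine Finset.sum_le_sum fun a _ => ?_
    nlinarith [sq_nonneg (Λ * (C⁻¹ *ᵥ u) a - u a)]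
  nlinarith

/-- For `w = C⁻¹ e_j`, coercivity reads `Λ w_j² ≤ Λ ‖w‖² ≤ w_j`. This bounds the variance of each
least squares coordinate. -/
theorem inv_diag_le (hΛ : 0 < Λ) (h : ∀ v : ι → ℝ, Λ * ∑ a, v a ^ 2 ≤ v ⬝ᵥ (C *ᵥ v)) (j : ι) :
    C⁻¹ j j ≤ 1 / Λ := by
  have h1 := h (C⁻¹ *ᵥ Pi.single j 1)
  rw [mul_inv_mulVec hΛ h] at h1
  simp only [dotProduct_single, mul_one] at h1
  have h2 : (C⁻¹ *ᵥ Pi.single j 1) j = C⁻¹ j j := by simp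
  have h3 : (C⁻¹ *ᵥ Pi.single j 1) j ^ 2 ≤ ∑ a, (C⁻¹ *ᵥ Pi.single j 1) a ^ 2 :=
    Finset.single_le_sum (f := fun a => (C⁻¹ *ᵥ Pi.single j 1) a ^ 2)
      (fun a _ => sq_nonneg _) (Finset.mem_univ j)
  rw [h2] at h1 h3
  rw [le_div_iff₀ hΛ]
  by_contra! hc
  have h4 : Λ * C⁻¹ j j ^ 2 ≤ C⁻¹ j j := le_trans (mul_le_mul_of_nonneg_left h3 hΛ.le) h1
  have h5 : 0 < C⁻¹ j j := pos_of_mul_pos_left (by linarith : 0 < C⁻¹ j j * Λ) hΛ.le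
  nlinarith

end Coercive

/-! ### Deterministic support recovery of the Lasso. -/

section Lasso

variable {n p : ℕ} {X : Matrix (Fin n) (Fin p) ℝ} {S : Finset (Fin p)} {Λ : ℝ}

theorem C11_isHermitian : (C11 X S).IsHermitian := by
  rw [C11_eq]
  simpa using Matrix.isHermitian_conjTranspose_mul_self ((1 / √(n : ℝ)) • cols X S)

theorem C11_inv_transpose : ((C11 X S)⁻¹)ᵀ = (C11 X S)⁻¹ := by
  have : (C11 X S)ᵀ = C11 X S := by
    simpa [Matrix.IsSymm] using C11_isHermitian (X := X) (S := S)
  rw [Matrix.transpose_nonsing_inv, this]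

theorem cols_transpose_mul_cols (hn : 0 < n) :
    (cols X S)ᵀ * cols X S = (n : ℝ) • C11 X S := by
  have : (n : ℝ) ≠ 0 := by positivity
  rw [C11, smul_smul, mul_one_div_cancel this, one_smul]

variable (X S) in
/-- The least squares operator `(1/n) C₁₁⁻¹ X_Sᵀ`. -/
def olsMatrix : Matrix {j // j ∈ S} (Fin n) ℝ :=
  (1 / (n : ℝ)) • ((C11 X S)⁻¹ * (cols X S)ᵀ)

variable (X S) in
/-- The orthogonal projection onto the range of `X_S`. -/
def hatMatrix : Matrix (Fin n) (Fin n) ℝ := cols X S * olsMatrix X S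

theorem hatMatrix_transpose : (hatMatrix X S)ᵀ = hatMatrix X S := by
  simp [hatMatrix, olsMatrix, Matrix.transpose_mul, C11_inv_transpose, Matrix.mul_assoc]

theorem olsMatrix_mul_cols (hn : 0 < n) (hu : IsUnit (C11 X S)) :
    olsMatrix X S * cols X S = 1 := by
  have : (n : ℝ) ≠ 0 := by positivity
  rw [olsMatrix, Matrix.smul_mul, Matrix.mul_assoc, cols_transpose_mul_cols hn, Matrix.mul_smul,
    smul_smul, Matrix.nonsing_inv_mul _ ((Matrix.isUnit_iff_isUnit_det _).1 hu),
    one_div_mul_cancel this, one_smul]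

theorem hatMatrix_mul_self (hn : 0 < n) (hu : IsUnit (C11 X S)) :
    hatMatrix X S * hatMatrix X S = hatMatrix X S := by
  rw [hatMatrix, Matrix.mul_assoc, ← Matrix.mul_assoc (olsMatrix X S), olsMatrix_mul_cols hn hu,
    Matrix.one_mul]

theorem sum_sq_olsMatrix_le (hn : 0 < n) (hΛ : 0 < Λ)
    (h : ∀ v : {j // j ∈ S} → ℝ, Λ * ∑ a, v a ^ 2 ≤ v ⬝ᵥ (C11 X S *ᵥ v)) (j : {j // j ∈ S}) :
    ∑ i, olsMatrix X S j i ^ 2 ≤ 1 / (n * Λ) := by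
  have h1 : olsMatrix X S * (olsMatrix X S)ᵀ = (1 / (n : ℝ)) • (C11 X S)⁻¹ := by
    conv_lhs => arg 2; rw [olsMatrix]
    rw [Matrix.transpose_smul, Matrix.transpose_mul, Matrix.transpose_transpose,
      C11_inv_transpose, Matrix.mul_smul, ← Matrix.mul_assoc,
      olsMatrix_mul_cols hn (isUnit_of_coercive hΛ h), Matrix.one_mul]
  have h2 : ∑ i, olsMatrix X S j i ^ 2 = 1 / n * (C11 X S)⁻¹ j j := by
    have := congrFun (congrFun h1 j) j
    simpa [Matrix.mul_apply, sq] using this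
  rw [h2, one_div_mul_eq_div, ← div_div, div_right_comm]
  exact div_le_div_of_nonneg_right (inv_diag_le hΛ h j) (by positivity)

/-- The hat matrix `H` is symmetric and idempotent, so `‖x - H x‖² = ‖x‖² - ‖H x‖²`. -/
theorem sum_sq_sub_hatMatrix_le (hn : 0 < n) (hu : IsUnit (C11 X S)) (x : Fin n → ℝ) :
    ∑ i, (x - hatMatrix X S *ᵥ x) i ^ 2 ≤ ∑ i, x i ^ 2 := by
  have h1 : (hatMatrix X S *ᵥ x) ⬝ᵥ (hatMatrix X S *ᵥ x) = x ⬝ᵥ (hatMatrix X S *ᵥ x) := by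
    rw [Matrix.dotProduct_mulVec, Matrix.vecMul_mulVec, hatMatrix_transpose,
      hatMatrix_mul_self hn hu, ← Matrix.mulVec_transpose, hatMatrix_transpose, dotProduct_comm]
  have h2 : ∑ i, (x - hatMatrix X S *ᵥ x) i ^ 2 = ∑ i, x i ^ 2 -
      2 * (x ⬝ᵥ (hatMatrix X S *ᵥ x)) + (hatMatrix X S *ᵥ x) ⬝ᵥ (hatMatrix X S *ᵥ x) := by
    simp only [dotProduct]
    rw [Finset.mul_sum, ← Finset.sum_sub_distrib, ← Finset.sum_add_distrib]
    refine Finset.sum_congr rfl fun i _ => ?_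
    simp only [Pi.sub_apply]
    ring
  have h3 : 0 ≤ (hatMatrix X S *ᵥ x) ⬝ᵥ (hatMatrix X S *ᵥ x) :=
    Finset.sum_nonneg fun i _ => mul_self_nonneg _
  rw [h2]
  linarith

theorem eq_zero_of_cols_mulVec (hΛ : 0 < Λ)
    (h : ∀ v : {j // j ∈ S} → ℝ, Λ * ∑ a, v a ^ 2 ≤ v ⬝ᵥ (C11 X S *ᵥ v)) {v : {j // j ∈ S} → ℝ}
    (hv : cols X S *ᵥ v = 0) : v = 0 := by
  have h1 := h v
  rw [C11, Matrix.smul_mulVec, ← Matrix.mulVec_mulVec, hv] at h1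
  simp only [Matrix.mulVec_zero, smul_zero, dotProduct_zero] at h1
  exact sum_sq_eq_zero (nonpos_of_mul_nonpos_right h1 hΛ)

theorem sign_mul_self_eq_abs (x : ℝ) : Real.sign x * x = |x| := by
  rcases lt_trichotomy x 0 with hx | rfl | hx
  · rw [Real.sign_of_neg hx, abs_of_neg hx, neg_one_mul]
  · simp
  · rw [Real.sign_of_pos hx, abs_of_pos hx, one_mul]

/-- The strict Karush-Kuhn-Tucker conditions characterize the Lasso minimizer. -/
theorem lasso_unique (hΛ : 0 < Λ)
    (h : ∀ v : {j // j ∈ S} → ℝ, Λ * ∑ a, v a ^ 2 ≤ v ⬝ᵥ (C11 X S *ᵥ v)) {y : Fin n → ℝ}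
    {lam : ℝ} (hlam : 0 < lam) {b b' : Fin p → ℝ} (hb : ∀ j, j ∉ S → b j = 0)
    (hS : ∀ j ∈ S, 2 * (Xᵀ *ᵥ (y - X *ᵥ b)) j = lam * Real.sign (b j))
    (hSc : ∀ j, j ∉ S → 2 * |(Xᵀ *ᵥ (y - X *ᵥ b)) j| < lam) (hb' : IsLasso X y lam b') :
    b' = b := by
  set d := b' - b with hd
  have hbd : b' = b + d := by simp [hd]
  set r := Xᵀ *ᵥ (y - X *ᵥ b) with hr
  have h1 := rss_add (X := X) y b d
  rw [← hbd, ← hr] at h1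
  have h2 := hb' b
  -- `2 r / lam` is a subgradient of the `ℓ¹` norm at `b`. Optimality of `b'` then forces all these
  -- nonnegative terms, and `‖X d‖²`, to vanish.
  have hterm : ∀ j, 0 ≤ lam * |b' j| - lam * |b j| - 2 * (r j * d j) := by
    intro j
    by_cases hj : j ∈ S
    · have e1 : 2 * (r j * d j) = lam * (Real.sign (b j) * b' j - Real.sign (b j) * b j) := by
        rw [← mul_assoc, hS j hj, hd, Pi.sub_apply]; ring
      have e2 : Real.sign (b j) * b j = |b j| := sign_mul_self_eq_abs (b j)
      have e3 : Real.sign (b j) * b' j ≤ |b' j| := by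
        rcases Real.sign_apply_eq (b j) with h | h | h <;> rw [h]
        · linarith [neg_abs_le (b' j)]
        · simp
        · linarith [le_abs_self (b' j)]
      rw [e1, e2]
      nlinarith
    · have e1 : d j = b' j := by simp [hd, hb j hj]
      rw [e1, hb j hj]
      have e2 : r j * b' j ≤ |r j| * |b' j| := (le_abs_self _).trans (abs_mul _ _).le
      have e3 : 2 * |r j| * |b' j| ≤ lam * |b' j| :=
        mul_le_mul_of_nonneg_right (hSc j hj).le (abs_nonneg _)
      simp only [abs_zero]
      linarith
  have hsum : ∑ j, (lam * |b' j| - lam * |b j| - 2 * (r j * d j)) + ∑ i, (X *ᵥ d) i ^ 2 ≤ 0 := by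
    simp only [Finset.sum_sub_distrib, ← Finset.mul_sum]
    linarith
  have hsum1 := Finset.sum_nonneg fun j (_ : j ∈ Finset.univ) => hterm j
  have hsum2 : 0 ≤ ∑ i, (X *ᵥ d) i ^ 2 := Finset.sum_nonneg fun i _ => sq_nonneg _
  have hX : X *ᵥ d = 0 := sum_sq_eq_zero (by linarith)
  have hz := (Finset.sum_eq_zero_iff_of_nonneg fun j _ => hterm j).1 (by linarith)
  -- Strict dual feasibility excludes a nonzero coordinate outside `S`; on `S`, injectivity of `X_S`
  -- finishes.
  have hoff : ∀ j, j ∉ S → d j = 0 := by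
    intro j hj
    have e0 := hz j (Finset.mem_univ j)
    have e1 : d j = b' j := by simp [hd, hb j hj]
    rw [hb j hj, ← e1, abs_zero] at e0
    by_contra hne
    have e2 : r j * d j ≤ |r j| * |d j| := (le_abs_self _).trans (abs_mul _ _).le
    have e3 : 2 * |r j| * |d j| < lam * |d j| :=
      mul_lt_mul_of_pos_right (hSc j hj) (abs_pos.2 hne)
    linarith
  have hon := eq_zero_of_cols_mulVec hΛ h ((cols_mulVec hoff).trans hX)
  have hd0 : d = 0 := by
    ext j
    by_cases hj : j ∈ S
    · exact congrFun hon ⟨j, hj⟩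
    · exact hoff j hj
  rw [hbd, hd0, add_zero]

theorem sign_add_of_abs_lt {x e : ℝ} (h : |e| < |x|) : x + e ≠ 0 ∧ Real.sign (x + e) =
    Real.sign x := by
  rw [abs_lt] at h
  rcases lt_trichotomy x 0 with hx | hx | hx
  · rw [abs_of_neg hx] at h
    have : x + e < 0 := by linarith
    exact ⟨this.ne, by rw [Real.sign_of_neg this, Real.sign_of_neg hx]⟩
  · rw [hx, abs_zero] at h; linarith
  · rw [abs_of_pos hx] at h
    have : 0 < x + e := by linarith
    exact ⟨this.ne', by rw [Real.sign_of_pos this, Real.sign_of_pos hx]⟩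

/-- Deterministic support recovery of the Lasso: the noise is small along the least squares
directions and after projection off the range of `X_S`. -/
theorem supp_lasso_eq (hn : 0 < n) (hΛ : 0 < Λ)
    (h : ∀ v : {j // j ∈ S} → ℝ, Λ * ∑ a, v a ^ 2 ≤ v ⬝ᵥ (C11 X S *ᵥ v))
    {lam η : ℝ} (hlam : 0 < lam) {b b' : Fin p → ℝ} (hb : S = supp b)
    (hIC : ∀ j : {j // j ∉ S}, |((C21 X S * (C11 X S)⁻¹) *ᵥ
      fun k : {k // k ∈ S} => Real.sign (b k)) j| ≤ 1 - η)
    {e : Fin n → ℝ}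
    (hS : ∀ j : {j // j ∈ S}, |(olsMatrix X S *ᵥ e) j| + lam / (2 * n) *
      |((C11 X S)⁻¹ *ᵥ fun k : {k // k ∈ S} => Real.sign (b k)) j| < |b j|)
    (hSc : ∀ j, j ∉ S → |(X.col j - hatMatrix X S *ᵥ X.col j) ⬝ᵥ e| < lam * η / 2)
    (hb' : IsLasso X (fun i => (X *ᵥ b) i + e i) lam b') : supp b' = S := by
  have hu := isUnit_of_coercive hΛ h
  have hn' : (n : ℝ) ≠ 0 := by positivity
  set sg : {j // j ∈ S} → ℝ := fun k => Real.sign (b k) with hsg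
  -- Primal-dual witness: `w` is the error on `S` that solves the stationarity equations with the
  -- true signs, namely the least squares noise minus the Lasso shrinkage. By `hdlt` it is too small
  -- to change a sign.
  set w : {j // j ∈ S} → ℝ := olsMatrix X S *ᵥ e - (lam / (2 * n)) • ((C11 X S)⁻¹ *ᵥ sg) with hw
  set d : Fin p → ℝ := fun j => if hj : j ∈ S then w ⟨j, hj⟩ else 0 with hd
  have hb0 : ∀ j, j ∉ S → b j = 0 := by
    intro j hj; rw [hb] at hj; simpa [supp] using hj
  have hd0 : ∀ j, j ∉ S → d j = 0 := fun j hj => by simp [hd, hj]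
  have hdw : (fun j : {j // j ∈ S} => d j) = w := by ext j; simp [hd]
  have hdlt : ∀ j ∈ S, |d j| < |b j| := by
    intro j hj
    have : d j = w ⟨j, hj⟩ := by simp [hd, hj]
    rw [this, hw]
    refine lt_of_le_of_lt ?_ (hS ⟨j, hj⟩)
    simp only [Pi.sub_apply, Pi.smul_apply, smul_eq_mul]
    refine (abs_sub _ _).trans ?_
    rw [abs_mul, abs_of_nonneg (by positivity : 0 ≤ lam / (2 * n))]
  have hres : (fun i => (X *ᵥ b) i + e i) - X *ᵥ (b + d) = e - cols X S *ᵥ w := by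
    rw [← hdw, cols_mulVec hd0, Matrix.mulVec_add]
    ext i; simp only [Pi.sub_apply, Pi.add_apply]; ring
  have hN : (cols X S)ᵀ *ᵥ (cols X S *ᵥ (olsMatrix X S *ᵥ e)) = (cols X S)ᵀ *ᵥ e := by
    rw [Matrix.mulVec_mulVec, cols_transpose_mul_cols hn, Matrix.smul_mulVec, olsMatrix,
      Matrix.smul_mulVec, ← Matrix.mulVec_mulVec, Matrix.mulVec_smul, mul_inv_mulVec hΛ h,
      smul_smul, mul_one_div_cancel hn', one_smul]
  have hsupp : b' = b + d := by
    refine lasso_unique hΛ h hlam (fun j hj => by simp [hb0 j hj, hd0 j hj]) ?_ ?_ hb'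
    · intro j hj
      have e1 : (Xᵀ *ᵥ (e - cols X S *ᵥ w)) j = ((cols X S)ᵀ *ᵥ (e - cols X S *ᵥ w)) ⟨j, hj⟩ := rfl
      rw [hres, e1, hw, Matrix.mulVec_sub, Matrix.mulVec_sub, Matrix.mulVec_sub, hN,
        Matrix.mulVec_smul, Matrix.mulVec_smul, Matrix.mulVec_mulVec _ (cols X S)ᵀ,
        cols_transpose_mul_cols hn, Matrix.smul_mulVec, mul_inv_mulVec hΛ h, Pi.add_apply,
        (sign_add_of_abs_lt (hdlt j hj)).2]
      simp only [Pi.sub_apply, Pi.smul_apply, smul_eq_mul, hsg]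
      field_simp
      ring
    · intro j hj
      have e1 : (Xᵀ *ᵥ (e - cols X S *ᵥ w)) j = X.col j ⬝ᵥ (e - cols X S *ᵥ w) := rfl
      have e2 : (X.col j - hatMatrix X S *ᵥ X.col j) ⬝ᵥ e =
          X.col j ⬝ᵥ e - X.col j ⬝ᵥ (cols X S *ᵥ (olsMatrix X S *ᵥ e)) := by
        rw [sub_dotProduct, Matrix.mulVec_mulVec, Matrix.dotProduct_mulVec, ← hatMatrix,
          ← Matrix.mulVec_transpose, hatMatrix_transpose]
      have e3 : X.col j ⬝ᵥ (cols X S *ᵥ ((C11 X S)⁻¹ *ᵥ sg)) =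
          n * ((C21 X S * (C11 X S)⁻¹) *ᵥ sg) ⟨j, hj⟩ := by
        rw [← Matrix.mulVec_mulVec, C21, Matrix.smul_mulVec, Pi.smul_apply, smul_eq_mul,
          ← mul_assoc, mul_one_div_cancel hn', one_mul, ← Matrix.mulVec_mulVec]
        rfl
      -- Off `S` the residual correlation is projected noise, below `lam η / 2`, plus an
      -- irrepresentable term of size at most `(lam / 2)(1 - η)`: together strictly below `lam / 2`.
      have e4 : X.col j ⬝ᵥ (e - cols X S *ᵥ w) = (X.col j - hatMatrix X S *ᵥ X.col j) ⬝ᵥ e +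
          lam / 2 * ((C21 X S * (C11 X S)⁻¹) *ᵥ sg) ⟨j, hj⟩ := by
        rw [e2, hw, Matrix.mulVec_sub, Matrix.mulVec_smul, dotProduct_sub, dotProduct_sub,
          dotProduct_smul, e3, smul_eq_mul]
        field_simp
        ring
      rw [hres, e1, e4]
      have e5 := abs_add_le ((X.col j - hatMatrix X S *ᵥ X.col j) ⬝ᵥ e)
        (lam / 2 * ((C21 X S * (C11 X S)⁻¹) *ᵥ sg) ⟨j, hj⟩)
      rw [abs_mul, abs_of_pos (by positivity : 0 < lam / 2)] at e5
      have e6 := mul_le_mul_of_nonneg_left (hIC ⟨j, hj⟩) (by positivity : 0 ≤ lam / 2)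
      have e7 := hSc j hj
      linarith
  rw [hsupp]
  ext j
  simp only [supp, Finset.mem_filter, Finset.mem_univ, true_and, Pi.add_apply]
  by_cases hj : j ∈ S
  · simp [hj, (sign_add_of_abs_lt (hdlt j hj)).1]
  · simp [hj, hb0 j hj, hd0 j hj]

end Lasso

/-! ### Tails and moments of linear and quadratic forms of Gaussian noise. -/

section GaussianNoise

open scoped NNReal

variable {Ω : Type*} [MeasurableSpace Ω] {P : Measure Ω} {v : ℝ≥0}

theorem memLp_gaussian {X : Ω → ℝ} (h : HasLaw X (gaussianReal 0 v) P) (q : ℝ≥0) :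
    MemLp X q P := by
  have h1 := memLp_id_gaussianReal (μ := 0) (v := v) q
  rw [← h.map_eq] at h1
  exact h1.comp_of_map h.aemeasurable

theorem integral_gaussian {X : Ω → ℝ} (h : HasLaw X (gaussianReal 0 v) P) : ∫ ω, X ω ∂P = 0 := by
  rw [h.integral_eq, integral_id_gaussianReal]

theorem integral_gaussian_pow {X : Ω → ℝ} (h : HasLaw X (gaussianReal 0 v) P) (k : ℕ) :
    ∫ ω, X ω ^ k ∂P = ∫ x, x ^ k ∂(gaussianReal 0 v) :=
  h.integral_comp (f := fun x => x ^ k) (by fun_prop)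

theorem hasSubgaussianMGF_gaussian {X : Ω → ℝ} (h : HasLaw X (gaussianReal 0 v) P) :
    HasSubgaussianMGF X v P where
  integrable_exp_mul t := by
    have h1 := integrable_exp_mul_gaussianReal (μ := 0) (v := v) t
    rw [← h.map_eq] at h1
    exact h1.comp_aemeasurable h.aemeasurable
  mgf_le t := by rw [mgf_gaussianReal h.map_eq]; simp

variable {n : ℕ} {e : Fin n → Ω → ℝ}

/-- Only an upper bound `L` on the squared norm is required, so that one variance proxy serves every
form in a union bound. -/
theorem hasSubgaussianMGF_linear (hind : iIndepFun e P)
    (hlaw : ∀ i, HasLaw (e i) (gaussianReal 0 v) P) {a : Fin n → ℝ} {L : ℝ≥0}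
    (hL : ∑ i, a i ^ 2 ≤ L) : HasSubgaussianMGF (fun ω => ∑ i, a i * e i ω) (v * L) P := by
  have h1 : iIndepFun (fun i ω => a i * e i ω) P :=
    hind.comp (fun i x => a i * x) fun i => by fun_prop
  have h2 := HasSubgaussianMGF.sum_of_iIndepFun h1 (s := Finset.univ) fun i _ =>
    (hasSubgaussianMGF_gaussian (hlaw i)).const_mul (a i)
  refine ⟨h2.integrable_exp_mul, fun t => (h2.mgf_le t).trans (Real.exp_le_exp.2 ?_)⟩
  rw [NNReal.coe_sum]
  have h3 : (∑ i, a i ^ 2) * v ≤ v * L := by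
    rw [mul_comm]; exact mul_le_mul_of_nonneg_left hL v.2
  have h4 : 0 ≤ t ^ 2 / 2 := by positivity
  have h5 := mul_le_mul_of_nonneg_right h3 h4
  rw [Finset.sum_mul] at h5
  push_cast
  rw [mul_div_assoc, mul_div_assoc]
  exact h5

theorem memLp_linear (hlaw : ∀ i, HasLaw (e i) (gaussianReal 0 v) P) (a : Fin n → ℝ) :
    MemLp (fun ω => a ⬝ᵥ fun i => e i ω) 2 P :=
  memLp_finsetSum _ fun i _ => (memLp_gaussian (hlaw i) 2).const_mul (a i)

variable [IsProbabilityMeasure P]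

theorem integral_linear (hlaw : ∀ i, HasLaw (e i) (gaussianReal 0 v) P) (a : Fin n → ℝ) :
    ∫ ω, a ⬝ᵥ (fun i => e i ω) ∂P = 0 := by
  simp only [dotProduct]
  rw [integral_finsetSum]
  · refine Finset.sum_eq_zero fun i _ => ?_
    rw [integral_const_mul, integral_gaussian (hlaw i), mul_zero]
  · exact fun i _ => ((memLp_gaussian (hlaw i) 1).integrable (by simp)).const_mul (a i)

theorem measureReal_abs_linear_ge_le (hind : iIndepFun e P)
    (hlaw : ∀ i, HasLaw (e i) (gaussianReal 0 v) P) {a : Fin n → ℝ} {L : ℝ≥0}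
    (hL : ∑ i, a i ^ 2 ≤ L) {t : ℝ} (ht : 0 ≤ t) :
    P.real {ω | t ≤ |a ⬝ᵥ fun i => e i ω|} ≤ 2 * Real.exp (-t ^ 2 / (2 * (v * L))) := by
  have h1 := hasSubgaussianMGF_linear hind hlaw hL
  have h2 := h1.measure_ge_le ht
  have h3 := h1.neg.measure_ge_le ht
  have hsub : {ω | t ≤ |a ⬝ᵥ fun i => e i ω|} ⊆
      {ω | t ≤ ∑ i, a i * e i ω} ∪ {ω | t ≤ (-fun ω => ∑ i, a i * e i ω) ω} := by
    intro ω hω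
    exact le_abs.1 (show t ≤ |a ⬝ᵥ fun i => e i ω| from hω)
  refine (measureReal_mono hsub).trans ((measureReal_union_le _ _).trans ?_)
  push_cast at h2 h3
  linarith

/-- Union bound for finitely many linear forms of the noise. -/
theorem measureReal_exists_linear_ge_le (hind : iIndepFun e P)
    (hlaw : ∀ i, HasLaw (e i) (gaussianReal 0 v) P) {κ : Type*} [Fintype κ] {a : κ → Fin n → ℝ}
    {L : ℝ≥0} (hL : ∀ k, ∑ i, a k i ^ 2 ≤ L) {t : ℝ} (ht : 0 ≤ t) :
    P.real {ω | ∃ k, t ≤ |a k ⬝ᵥ fun i => e i ω|} ≤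
      Fintype.card κ * (2 * Real.exp (-t ^ 2 / (2 * (v * L)))) := by
  have h1 : {ω | ∃ k, t ≤ |a k ⬝ᵥ fun i => e i ω|} =
      ⋃ k ∈ Finset.univ, {ω | t ≤ |a k ⬝ᵥ fun i => e i ω|} := by ext; simp
  rw [h1]
  refine (measureReal_biUnion_finset_le _ _).trans ?_
  refine (Finset.sum_le_sum fun k _ => measureReal_abs_linear_ge_le hind hlaw (hL k) ht).trans ?_
  simp

theorem integral_linear_sq (hind : iIndepFun e P)
    (hlaw : ∀ i, HasLaw (e i) (gaussianReal 0 v) P) (a : Fin n → ℝ) :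
    ∫ ω, (a ⬝ᵥ fun i => e i ω) ^ 2 ∂P = v * ∑ i, a i ^ 2 := by
  have h0 : iIndepFun (fun i ω => a i * e i ω) P :=
    hind.comp (fun i x => a i * x) fun i => by fun_prop
  have h1 := IndepFun.variance_sum (μ := P) (s := Finset.univ) (X := fun i ω => a i * e i ω)
    (fun i _ => (memLp_gaussian (hlaw i) 2).const_mul (a i))
    (fun i _ j _ hij => h0.indepFun hij)
  have h2 : (∑ i, fun ω => a i * e i ω) = fun ω => a ⬝ᵥ fun i => e i ω := by
    ext ω; simp [dotProduct]
  rw [h2, variance_of_integral_eq_zero (memLp_linear hlaw a).aemeasurable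
    (integral_linear hlaw a)] at h1
  rw [h1, Finset.mul_sum]
  refine Finset.sum_congr rfl fun i _ => ?_
  rw [variance_const_mul, (hlaw i).variance_eq, variance_id_gaussianReal, mul_comm]

theorem integral_const_add_linear_sq (hind : iIndepFun e P)
    (hlaw : ∀ i, HasLaw (e i) (gaussianReal 0 v) P) (a : Fin n → ℝ) (c : ℝ) :
    ∫ ω, (c + a ⬝ᵥ fun i => e i ω) ^ 2 ∂P = c ^ 2 + v * ∑ i, a i ^ 2 := by
  have hm := memLp_linear hlaw a
  have h1 : ∀ ω, (c + a ⬝ᵥ fun i => e i ω) ^ 2 =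
      (c ^ 2 + 2 * c * (a ⬝ᵥ fun i => e i ω)) + (a ⬝ᵥ fun i => e i ω) ^ 2 := fun ω => by ring
  have hi : Integrable (fun ω => a ⬝ᵥ fun i => e i ω) P := hm.integrable (by simp)
  have hi' : Integrable (fun ω => c ^ 2 + 2 * c * (a ⬝ᵥ fun i => e i ω)) P :=
    (integrable_const _).add (hi.const_mul _)
  simp only [h1]
  rw [integral_add hi' hm.integrable_sq,
    integral_add (integrable_const _) (hi.const_mul _), integral_const_mul,
    integral_linear hlaw, integral_linear_sq hind hlaw]
  simp

/-- The bound follows from `‖m + e‖² ≤ 2‖m‖² + 2‖e‖²`, squared, and Cauchy-Schwarz `‖e‖⁴ ≤ n ∑ eᵢ⁴`.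
It is crude, but polynomial growth suffices against an exponentially small failure probability. -/
theorem integrable_sum_sq_sq (hlaw : ∀ i, HasLaw (e i) (gaussianReal 0 v) P) (m : Fin n → ℝ) :
    Integrable (fun ω => (∑ i, (m i + e i ω) ^ 2) ^ 2) P ∧
    ∫ ω, (∑ i, (m i + e i ω) ^ 2) ^ 2 ∂P ≤
      8 * (∑ i, m i ^ 2) ^ 2 + 8 * (n ^ 2 * ∫ x, x ^ 4 ∂(gaussianReal 0 v)) := by
  have h4 : ∀ i, Integrable (fun ω => e i ω ^ 4) P := by
    intro i
    have := (memLp_gaussian (hlaw i) ((4 : ℕ) : ℝ≥0)).integrable_norm_pow (p := 4) (by norm_num)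
    refine this.congr (Eventually.of_forall fun ω => ?_)
    simp only [Real.norm_eq_abs]
    exact Even.pow_abs (by decide) _
  have hb : ∀ ω, (∑ i, (m i + e i ω) ^ 2) ^ 2 ≤
      8 * (∑ i, m i ^ 2) ^ 2 + 8 * (n * ∑ i, e i ω ^ 4) := by
    intro ω
    have e1 : ∑ i, (m i + e i ω) ^ 2 ≤ 2 * ∑ i, m i ^ 2 + 2 * ∑ i, e i ω ^ 2 := by
      rw [Finset.mul_sum, Finset.mul_sum, ← Finset.sum_add_distrib]
      exact Finset.sum_le_sum fun i _ => by nlinarith [sq_nonneg (m i - e i ω)]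
    have e2 : (∑ i, e i ω ^ 2) ^ 2 ≤ n * ∑ i, e i ω ^ 4 := by
      have := sq_sum_le_card_mul_sum_sq (s := (Finset.univ : Finset (Fin n)))
        (f := fun i => e i ω ^ 2)
      simpa [← pow_mul] using this
    have e0 : 0 ≤ ∑ i, (m i + e i ω) ^ 2 := Finset.sum_nonneg fun i _ => sq_nonneg _
    have e3 := pow_le_pow_left₀ e0 e1 2
    nlinarith [sq_nonneg (∑ i, m i ^ 2 - ∑ i, e i ω ^ 2)]
  have hi : Integrable (fun ω => 8 * (∑ i, m i ^ 2) ^ 2 + 8 * (n * ∑ i, e i ω ^ 4)) P :=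
    (integrable_const _).add (((integrable_finsetSum _ fun i _ => h4 i).const_mul _).const_mul _)
  have hm : AEStronglyMeasurable (fun ω => (∑ i, (m i + e i ω) ^ 2) ^ 2) P := by
    have : ∀ i, AEMeasurable (e i) P := fun i => (hlaw i).aemeasurable
    exact AEMeasurable.aestronglyMeasurable (by fun_prop)
  refine ⟨hi.mono' hm (Eventually.of_forall fun ω => ?_), ?_⟩
  · rw [Real.norm_of_nonneg (sq_nonneg _)]; exact hb ω
  · refine (integral_mono_of_nonneg (Eventually.of_forall fun ω => sq_nonneg _) hi
      (Eventually.of_forall hb)).trans (le_of_eq ?_)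
    rw [integral_add (integrable_const _)
      (((integrable_finsetSum _ fun i _ => h4 i).const_mul _).const_mul _), integral_const,
      integral_const_mul, integral_const_mul, integral_finsetSum _ fun i _ => h4 i]
    simp only [integral_gaussian_pow (hlaw _)]
    simp
    ring

end GaussianNoise

/-! ### Bias and mean squared error of linear estimators, fixed or selected. -/

theorem sum_sq_mulVec_le {m n : ℕ} (A : Matrix (Fin m) (Fin n) ℝ) (y : Fin n → ℝ) :
    ∑ j, (A *ᵥ y) j ^ 2 ≤ (∑ j, ∑ i, A j i ^ 2) * ∑ i, y i ^ 2 := by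
  rw [Finset.sum_mul]
  exact Finset.sum_le_sum fun j _ =>
    Finset.sum_mul_sq_le_sq_mul_sq Finset.univ (A j) y

section Moments

open scoped NNReal

variable {Ω : Type*} [MeasurableSpace Ω] {P : Measure Ω} [IsProbabilityMeasure P] {n p : ℕ}
  {X : Matrix (Fin n) (Fin p) ℝ} {β : EuclideanSpace ℝ (Fin p)}
  {e : Fin n → Ω → ℝ} {v : ℝ≥0}

/-- Applying a linear estimator to the response. -/
def linEst (A : Matrix (Fin p) (Fin n) ℝ) (y : Fin n → ℝ) : EuclideanSpace ℝ (Fin p) :=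
  WithLp.toLp 2 (A *ᵥ y)

theorem linEst_response_apply {Ω : Type*} {e : Fin n → Ω → ℝ} (A : Matrix (Fin p) (Fin n) ℝ) (ω : Ω) (j : Fin p) :
    linEst A (response X β e ω) j = (A *ᵥ (X *ᵥ β.ofLp)) j + A j ⬝ᵥ fun i => e i ω := by
  have : response X β e ω = X *ᵥ β.ofLp + fun i => e i ω := rfl
  simp only [linEst]
  rw [this, Matrix.mulVec_add]
  rfl

theorem memLp_linEst (hlaw : ∀ i, HasLaw (e i) (gaussianReal 0 v) P)
    (A : Matrix (Fin p) (Fin n) ℝ) : MemLp (fun ω => linEst A (response X β e ω)) 2 P := by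
  refine MemLp.of_eval_piLp fun j => ?_
  have h : MemLp (fun ω => (A *ᵥ (X *ᵥ β.ofLp)) j + A j ⬝ᵥ fun i => e i ω) 2 P :=
    (memLp_const ((A *ᵥ (X *ᵥ β.ofLp)) j)).add (memLp_linear hlaw (A j))
  simpa only [linEst_response_apply] using h

theorem integral_linEst (hlaw : ∀ i, HasLaw (e i) (gaussianReal 0 v) P)
    (A : Matrix (Fin p) (Fin n) ℝ) :
    ∫ ω, linEst A (response X β e ω) ∂P = WithLp.toLp 2 (A *ᵥ (X *ᵥ β.ofLp)) := by
  ext j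
  have h := memLp_linEst (X := X) (β := β) hlaw A
  rw [eval_integral_piLp fun i => (h.eval_piLp i).integrable (by simp)]
  simp only [linEst_response_apply]
  rw [integral_add (integrable_const _) ((memLp_linear hlaw _).integrable (by simp)),
    integral_linear hlaw]
  simp

theorem integral_linEst_sub_sq (hind : iIndepFun e P)
    (hlaw : ∀ i, HasLaw (e i) (gaussianReal 0 v) P) (A : Matrix (Fin p) (Fin n) ℝ) :
    ∫ ω, ‖linEst A (response X β e ω) - β‖ ^ 2 ∂P =
      ∑ j, ((A *ᵥ (X *ᵥ β.ofLp)) j - β j) ^ 2 + v * ∑ j, ∑ i, A j i ^ 2 := by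
  have h1 : ∀ ω, ‖linEst A (response X β e ω) - β‖ ^ 2 =
      ∑ j, (((A *ᵥ (X *ᵥ β.ofLp)) j - β j) + A j ⬝ᵥ fun i => e i ω) ^ 2 := by
    intro ω
    rw [EuclideanSpace.norm_sq_eq]
    refine Finset.sum_congr rfl fun j _ => ?_
    rw [PiLp.sub_apply, linEst_response_apply, Real.norm_eq_abs, sq_abs]
    ring
  simp only [h1]
  rw [integral_finsetSum, Finset.mul_sum, ← Finset.sum_add_distrib]
  · exact Finset.sum_congr rfl fun j _ => integral_const_add_linear_sq hind hlaw _ _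
  · intro j _
    have h : MemLp (fun ω => ((A *ᵥ (X *ᵥ β.ofLp)) j - β j) + A j ⬝ᵥ fun i => e i ω) 2 P :=
      (memLp_const ((A *ᵥ (X *ᵥ β.ofLp)) j - β j)).add (memLp_linear hlaw (A j))
    exact h.integrable_sq

theorem norm_linEst_sq_le (A : Matrix (Fin p) (Fin n) ℝ) (y : Fin n → ℝ) :
    ‖linEst A y‖ ^ 2 ≤ (∑ j, ∑ i, A j i ^ 2) * ∑ i, y i ^ 2 := by
  rw [EuclideanSpace.norm_sq_eq]
  simpa [linEst] using sum_sq_mulVec_le A y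

variable {T : Ω → Finset (Fin p)} {A : Finset (Fin p) → Matrix (Fin p) (Fin n) ℝ}

/-- The selected set takes finitely many values, so the estimator is a finite sum of linear
estimators cut off to the level sets of `T`. -/
theorem memLp_select (hlaw : ∀ i, HasLaw (e i) (gaussianReal 0 v) P)
    (hT : ∀ t, MeasurableSet (T ⁻¹' {t})) :
    MemLp (fun ω => linEst (A (T ω)) (response X β e ω)) 2 P := by
  have h1 : (fun ω => linEst (A (T ω)) (response X β e ω)) = fun ω => ∑ t,
      (T ⁻¹' {t}).indicator (fun ω => linEst (A t) (response X β e ω)) ω := by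
    ext1 ω
    rw [Finset.sum_eq_single (T ω)]
    · simp
    · intro t _ ht
      exact Set.indicator_of_notMem (fun h => ht (by simpa using h.symm)) _
    · simp
  rw [h1]
  exact memLp_finsetSum _ fun t _ => (memLp_linEst hlaw (A t)).indicator (hT t)

/-- The mean squared effect of selecting a wrong set. -/
theorem integral_select_sub_sq_le (hlaw : ∀ i, HasLaw (e i) (gaussianReal 0 v) P)
    (hT : ∀ t, MeasurableSet (T ⁻¹' {t})) {S : Finset (Fin p)} {B Q : ℝ} (hQ : 0 < Q)
    (hB : ∀ t, ∑ j, ∑ i, A t j i ^ 2 ≤ B) (hPQ : P.real {ω | T ω ≠ S} ≤ Q) :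
    ∫ ω, ‖linEst (A (T ω)) (response X β e ω) - linEst (A S) (response X β e ω)‖ ^ 2 ∂P ≤
      √Q * (1 + 16 * B ^ 2 * (8 * (∑ i, (X *ᵥ β.ofLp) i ^ 2) ^ 2 +
        8 * (n ^ 2 * ∫ x, x ^ 4 ∂(gaussianReal 0 v)))) := by
  set N : Ω → ℝ := fun ω => ∑ i, ((X *ᵥ β.ofLp) i + e i ω) ^ 2 with hN
  obtain ⟨hNi, hNb⟩ := integrable_sum_sq_sq hlaw (X *ᵥ β.ofLp)
  set E : Set Ω := {ω | T ω ≠ S} with hE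
  have hEm : MeasurableSet E := (hT S).compl
  have hr : 0 < √Q := Real.sqrt_pos.2 hQ
  -- A pointwise weighted mean inequality replaces Cauchy-Schwarz: on `E` the left side is at most
  -- `4 B N`, and the weight `√Q` balances the two terms since `P(E) / √Q ≤ √Q`.
  have hpt : ∀ ω, ‖linEst (A (T ω)) (response X β e ω) - linEst (A S) (response X β e ω)‖ ^ 2 ≤
      (√Q)⁻¹ * E.indicator 1 ω + √Q * (16 * B ^ 2 * N ω ^ 2) := by
    intro ω
    by_cases hω : T ω = S
    · rw [hω, sub_self, norm_zero, zero_pow two_ne_zero]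
      have : 0 ≤ E.indicator (1 : Ω → ℝ) ω := Set.indicator_nonneg (fun _ _ => zero_le_one) _
      positivity
    · have h0 : 0 ≤ N ω := Finset.sum_nonneg fun i _ => sq_nonneg _
      have h1 : _ ≤ B * N ω := (norm_linEst_sq_le (A (T ω)) (response X β e ω)).trans
        (mul_le_mul_of_nonneg_right (hB _) h0)
      have h2 : _ ≤ B * N ω := (norm_linEst_sq_le (A S) (response X β e ω)).trans
        (mul_le_mul_of_nonneg_right (hB _) h0)
      have h3 := norm_sub_le (linEst (A (T ω)) (response X β e ω))
        (linEst (A S) (response X β e ω))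
      have h4 : ‖linEst (A (T ω)) (response X β e ω) - linEst (A S) (response X β e ω)‖ ^ 2 ≤
          4 * (B * N ω) := by
        have := pow_le_pow_left₀ (norm_nonneg _) h3 2
        nlinarith [sq_nonneg (‖linEst (A (T ω)) (response X β e ω)‖ -
          ‖linEst (A S) (response X β e ω)‖)]
      rw [Set.indicator_of_mem (show ω ∈ E from hω), Pi.one_apply, mul_one]
      refine h4.trans ?_
      have h5 : (√Q)⁻¹ * √Q = 1 := inv_mul_cancel₀ hr.ne'
      have h6 : 0 < (√Q)⁻¹ := by positivity
      have h7 : (√Q)⁻¹ + √Q * (16 * B ^ 2 * N ω ^ 2) - 4 * (B * N ω) =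
          (√Q)⁻¹ * ((√Q * (4 * (B * N ω)) - 1 / 2) ^ 2 + 3 / 4) := by
        have : √Q ≠ 0 := hr.ne'
        field_simp
        ring
      have h8 : 0 ≤ (√Q)⁻¹ * ((√Q * (4 * (B * N ω)) - 1 / 2) ^ 2 + 3 / 4) := by positivity
      linarith
  have hi1 : Integrable (fun ω => (√Q)⁻¹ * E.indicator (1 : Ω → ℝ) ω) P :=
    ((integrable_const (1 : ℝ)).indicator hEm).const_mul _
  have hi2 : Integrable (fun ω => √Q * (16 * B ^ 2 * N ω ^ 2)) P :=
    (hNi.const_mul _).const_mul _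
  refine (integral_mono_of_nonneg (Eventually.of_forall fun ω => sq_nonneg _) (hi1.add hi2)
    (Eventually.of_forall hpt)).trans ?_
  simp only [Pi.add_apply]
  rw [integral_add hi1 hi2, integral_const_mul, integral_const_mul, integral_const_mul,
    integral_indicator_one hEm, mul_add, mul_one]
  refine add_le_add ?_ ?_
  · calc (√Q)⁻¹ * P.real E ≤ (√Q)⁻¹ * Q := by gcongr
      _ = √Q := by
        rw [inv_mul_eq_div, div_eq_iff hr.ne', Real.mul_self_sqrt hQ.le]
  · gcongr

/-- Bias and mean squared error of a linear estimator applied after selection. -/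
theorem select_moments (hind : iIndepFun e P) (hlaw : ∀ i, HasLaw (e i) (gaussianReal 0 v) P)
    (hT : ∀ t, MeasurableSet (T ⁻¹' {t})) {S : Finset (Fin p)} {R δ Φ : ℝ}
    (hR : ∫ ω, ‖linEst (A (T ω)) (response X β e ω) - linEst (A S) (response X β e ω)‖ ^ 2 ∂P ≤ R)
    (hδ : ∑ j, ((A S *ᵥ (X *ᵥ β.ofLp)) j - β j) ^ 2 ≤ δ)
    (hΦ : ∑ j, ∑ i, A S j i ^ 2 ≤ Φ) :
    ‖(∫ ω, linEst (A (T ω)) (response X β e ω) ∂P) - β‖ ^ 2 ≤ 2 * δ + 2 * R ∧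
    ∫ ω, ‖linEst (A (T ω)) (response X β e ω) - β‖ ^ 2 ∂P ≤ 2 * (δ + v * Φ) + 2 * R := by
  set bt : Ω → EuclideanSpace ℝ (Fin p) := fun ω => linEst (A (T ω)) (response X β e ω) with hbt
  set Z : Ω → EuclideanSpace ℝ (Fin p) := fun ω => linEst (A S) (response X β e ω) with hZ
  have m1 : MemLp bt 2 P := memLp_select hlaw hT
  have m2 : MemLp Z 2 P := memLp_linEst hlaw (A S)
  have m3 : MemLp (fun ω => bt ω - Z ω) 2 P := m1.sub m2
  have m4 : MemLp (fun ω => Z ω - β) 2 P := m2.sub (memLp_const β)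
  have i3 : Integrable (fun ω => ‖bt ω - Z ω‖ ^ 2) P := m3.integrable_norm_pow (p := 2) two_ne_zero
  have i4 : Integrable (fun ω => ‖Z ω - β‖ ^ 2) P := m4.integrable_norm_pow (p := 2) two_ne_zero
  have hpar : ∀ x y : EuclideanSpace ℝ (Fin p), ‖x + y‖ ^ 2 ≤ 2 * ‖x‖ ^ 2 + 2 * ‖y‖ ^ 2 := by
    intro x y
    have := pow_le_pow_left₀ (norm_nonneg _) (norm_add_le x y) 2
    nlinarith [sq_nonneg (‖x‖ - ‖y‖)]
  constructor
  · have h1 : (∫ ω, bt ω ∂P) - β = ((∫ ω, Z ω ∂P) - β) + ∫ ω, (bt ω - Z ω) ∂P := by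
      rw [integral_sub (m1.integrable (by simp)) (m2.integrable (by simp))]
      abel
    have h2 : ‖(∫ ω, Z ω ∂P) - β‖ ^ 2 ≤ δ := by
      rw [integral_linEst hlaw, EuclideanSpace.norm_sq_eq]
      simpa using hδ
    have h3 : ‖∫ ω, (bt ω - Z ω) ∂P‖ ^ 2 ≤ R := by
      refine le_trans ?_ hR
      set c := ∫ ω, ‖bt ω - Z ω‖ ∂P with hc
      have c1 : ‖∫ ω, (bt ω - Z ω) ∂P‖ ≤ c := norm_integral_le_integral_norm _
      -- Integrating `2 c x ≤ c² + x²` with `c` the mean of `x` yields Jensen's inequality `c² ≤ E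
      -- x²`.
      have c2 : ∫ ω, 2 * c * ‖bt ω - Z ω‖ ∂P ≤ ∫ ω, (c ^ 2 + ‖bt ω - Z ω‖ ^ 2) ∂P := by
        refine integral_mono ((m3.integrable (by simp)).norm.const_mul _)
          ((integrable_const _).add i3) fun ω => ?_
        nlinarith [sq_nonneg (c - ‖bt ω - Z ω‖)]
      rw [integral_const_mul, ← hc, integral_add (integrable_const _) i3] at c2
      simp only [integral_const, probReal_univ, smul_eq_mul, one_mul] at c2
      have := pow_le_pow_left₀ (norm_nonneg _) c1 2
      nlinarith
    rw [h1]
    exact (hpar _ _).trans (by linarith)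
  · have h1 : ∫ ω, ‖Z ω - β‖ ^ 2 ∂P ≤ δ + v * Φ := by
      rw [hZ, integral_linEst_sub_sq hind hlaw]
      exact add_le_add hδ (mul_le_mul_of_nonneg_left hΦ v.2)
    have h2 : ∫ ω, ‖bt ω - β‖ ^ 2 ∂P ≤ ∫ ω, (2 * ‖Z ω - β‖ ^ 2 + 2 * ‖bt ω - Z ω‖ ^ 2) ∂P := by
      refine integral_mono_of_nonneg (Eventually.of_forall fun ω => sq_nonneg _)
        ((i4.const_mul _).add (i3.const_mul _)) (Eventually.of_forall fun ω => ?_)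
      have := hpar (Z ω - β) (bt ω - Z ω)
      rwa [sub_add_sub_comm, add_comm (Z ω), add_sub_add_right_eq_sub] at this
    rw [integral_add (i4.const_mul _) (i3.const_mul _), integral_const_mul,
      integral_const_mul] at h2
    linarith

end Moments

/-! ### Comparison of powers and stretched exponentials. -/

section Growth

theorem tendsto_rpow_mul_exp_neg_rpow (m : ℝ) {κ c : ℝ} (hκ : 0 < κ) (hc : 0 < c) :
    Tendsto (fun n : ℕ => (n : ℝ) ^ m * Real.exp (-κ * (n : ℝ) ^ c)) atTop (𝓝 0) := by
  have h1 := (tendsto_rpow_mul_exp_neg_mul_atTop_nhds_zero (m / c) κ hκ).comp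
    ((tendsto_rpow_atTop hc).comp tendsto_natCast_atTop_atTop)
  refine h1.congr fun n => ?_
  simp only [Function.comp_apply]
  rw [← Real.rpow_mul (Nat.cast_nonneg n), mul_div_cancel₀ _ hc.ne']

theorem eventually_mul_rpow_le {c d : ℝ} (hcd : c < d) (a : ℝ) {κ : ℝ} (hκ : 0 < κ) :
    ∀ᶠ n : ℕ in atTop, a * (n : ℝ) ^ c ≤ κ * (n : ℝ) ^ d := by
  have h1 := (tendsto_rpow_atTop (sub_pos.2 hcd)).comp (tendsto_natCast_atTop_atTop (R := ℝ))
  filter_upwards [h1.eventually_ge_atTop (a / κ), eventually_gt_atTop 0] with n hn hn0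
  have hn0' : (0 : ℝ) < n := by exact_mod_cast hn0
  simp only [Function.comp_apply] at hn
  have h2 : (n : ℝ) ^ d = (n : ℝ) ^ (d - c) * (n : ℝ) ^ c := by
    rw [← Real.rpow_add hn0']; simp
  rw [div_le_iff₀ hκ] at hn
  rw [h2, ← mul_assoc]
  exact mul_le_mul_of_nonneg_right (by linarith) (by positivity)

/-- Half of `κ n^d` absorbs `a n^c`; the other half kills the power. -/
theorem tendsto_rpow_mul_exp_sub (m a : ℝ) {κ c d : ℝ} (hκ : 0 < κ) (hcd : c < d) (hd : 0 < d) :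
    Tendsto (fun n : ℕ => (n : ℝ) ^ m * Real.exp (a * (n : ℝ) ^ c - κ * (n : ℝ) ^ d))
      atTop (𝓝 0) := by
  refine tendsto_of_tendsto_of_tendsto_of_le_of_le' tendsto_const_nhds
    (tendsto_rpow_mul_exp_neg_rpow m (half_pos hκ) hd)
    (Eventually.of_forall fun n => by positivity) ?_
  filter_upwards [eventually_mul_rpow_le hcd a (half_pos hκ)] with n hn
  gcongr
  linarith

theorem exp_neg_rpow_isLittleO {c : ℝ} (hc : 0 < c) :
    (fun n : ℕ => Real.exp (-(n : ℝ) ^ c / 2)) =o[atTop] fun n : ℕ => 1 / (n : ℝ) := by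
  rw [isLittleO_iff_tendsto']
  · refine (tendsto_rpow_mul_exp_neg_rpow 1 (half_pos one_pos) hc).congr fun n => ?_
    rw [Real.rpow_one, div_div_eq_mul_div, div_one, mul_comm]
    congr 2
    ring
  · filter_upwards [eventually_gt_atTop 0] with n hn h
    have : (0 : ℝ) < n := by exact_mod_cast hn
    exact absurd h (by positivity)

/-- The bound for the effect of a wrong selection decays faster than `exp (-n ^ c / 2)`. -/
theorem selection_error_isLittleO {c d κ a b u w : ℝ} (hκ : 0 < κ) (hcd : c < d) (hc : 0 < c)
    (ha : 0 ≤ a) {V : ℕ → ℝ} (hw : 0 ≤ w) (hV0 : ∀ n, 0 ≤ V n)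
    (hV : ∀ᶠ n : ℕ in atTop, V n ≤ u * (n : ℝ) ^ 2) :
    (fun n : ℕ => √(a * Real.exp ((n : ℝ) ^ c - κ * (n : ℝ) ^ d)) *
      (1 + 16 * (b * (n : ℝ) ^ 2 * Real.exp (2 * (n : ℝ) ^ c)) ^ 2 *
        (8 * V n ^ 2 + 8 * ((n : ℝ) ^ 2 * w)))) =o[atTop]
      fun n : ℕ => Real.exp (-(n : ℝ) ^ c / 2) := by
  rw [isLittleO_iff_tendsto fun n h => absurd h (Real.exp_pos _).ne']
  -- With `x = n^c`: the power `8` is `4` from the squared gain plus `4` from `V²`. The coefficient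
  -- `5` of `x` is `4` from the squared gain, `1/2` from the square root and `1/2` from dividing by
  -- `exp(-x/2)`. The root also halves `κ`.
  have hlim := (tendsto_rpow_mul_exp_sub 8 5 (half_pos hκ) hcd (hc.trans hcd)).const_mul
    (√a * (1 + 16 * b ^ 2 * (8 * u ^ 2 + 8 * w)))
  rw [mul_zero] at hlim
  refine tendsto_of_tendsto_of_tendsto_of_le_of_le' tendsto_const_nhds hlim
    (Eventually.of_forall fun n => by positivity) ?_
  filter_upwards [hV, eventually_ge_atTop 1] with n hn hn1
  have hn1' : (1 : ℝ) ≤ n := by exact_mod_cast hn1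
  set x := (n : ℝ) ^ c
  set z := (n : ℝ) ^ d
  have hx : 0 ≤ x := by positivity
  have h1 : √(a * Real.exp (x - κ * z)) = √a * Real.exp ((x - κ * z) / 2) := by
    rw [Real.sqrt_mul ha, ← Real.exp_half]
  have h2 : V n ^ 2 ≤ u ^ 2 * (n : ℝ) ^ 4 := by
    calc V n ^ 2 ≤ (u * (n : ℝ) ^ 2) ^ 2 := pow_le_pow_left₀ (hV0 n) hn 2
      _ = u ^ 2 * (n : ℝ) ^ 4 := by ring
  have h3 : (n : ℝ) ^ 2 ≤ (n : ℝ) ^ 4 := pow_le_pow_right₀ hn1' (by norm_num)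
  have h4 : Real.exp (2 * x) ^ 2 = Real.exp (4 * x) := by
    rw [← Real.exp_nat_mul]; congr 1; push_cast; ring
  have h5 : 1 ≤ (n : ℝ) ^ 8 * Real.exp (4 * x) :=
    one_le_mul_of_one_le_of_one_le (one_le_pow₀ hn1') (Real.one_le_exp (by positivity))
  have h6 : 1 + 16 * (b * (n : ℝ) ^ 2 * Real.exp (2 * x)) ^ 2 *
      (8 * V n ^ 2 + 8 * ((n : ℝ) ^ 2 * w)) ≤
      (1 + 16 * b ^ 2 * (8 * u ^ 2 + 8 * w)) * ((n : ℝ) ^ 8 * Real.exp (4 * x)) := by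
    have e1 : (b * (n : ℝ) ^ 2 * Real.exp (2 * x)) ^ 2 = b ^ 2 * (n : ℝ) ^ 4 * Real.exp (4 * x) := by
      rw [mul_pow, h4]; ring
    have e2 : 8 * V n ^ 2 + 8 * ((n : ℝ) ^ 2 * w) ≤ (8 * u ^ 2 + 8 * w) * (n : ℝ) ^ 4 := by
      have := mul_le_mul_of_nonneg_right h3 hw
      linarith
    rw [e1]
    calc _ ≤ (n : ℝ) ^ 8 * Real.exp (4 * x) + 16 * (b ^ 2 * (n : ℝ) ^ 4 * Real.exp (4 * x)) *
          ((8 * u ^ 2 + 8 * w) * (n : ℝ) ^ 4) := by gcongr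
      _ = _ := by ring
  rw [h1, div_le_iff₀ (Real.exp_pos _)]
  calc √a * Real.exp ((x - κ * z) / 2) * _
      ≤ √a * Real.exp ((x - κ * z) / 2) * ((1 + 16 * b ^ 2 * (8 * u ^ 2 + 8 * w)) *
        ((n : ℝ) ^ 8 * Real.exp (4 * x))) := by gcongr
    _ = √a * (1 + 16 * b ^ 2 * (8 * u ^ 2 + 8 * w)) *
        ((n : ℝ) ^ (8 : ℝ) * Real.exp (5 * x - κ / 2 * z)) * Real.exp (-x / 2) := by
      have e1 : (n : ℝ) ^ (8 : ℝ) = (n : ℝ) ^ 8 := by exact_mod_cast Real.rpow_natCast (n : ℝ) 8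
      have e2 : Real.exp ((x - κ * z) / 2) * Real.exp (4 * x) =
          Real.exp (5 * x - κ / 2 * z) * Real.exp (-x / 2) := by
        rw [← Real.exp_add, ← Real.exp_add]; congr 1; ring
      rw [e1]
      linear_combination (√a * (1 + 16 * b ^ 2 * (8 * u ^ 2 + 8 * w)) * (n : ℝ) ^ 8) * e2

end Growth

/-! ### From moment bounds at fixed `n` to rates. -/

section Sequences

variable {Ω : ℕ → Type*} [∀ n, MeasurableSpace (Ω n)] {P : ∀ n, Measure (Ω n)}
  [∀ n, IsProbabilityMeasure (P n)] {p : ℕ → ℕ} {X : ∀ n, Matrix (Fin n) (Fin (p n)) ℝ}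
  {βs : ∀ n, EuclideanSpace ℝ (Fin (p n))} {ε : ∀ n, Fin n → Ω n → ℝ}

theorem measurableSet_supp_preimage {α : Type*} [MeasurableSpace α] {q : ℕ} {f : α → Fin q → ℝ}
    (hf : Measurable f) (t : Finset (Fin q)) :
    MeasurableSet ((fun ω => supp (f ω)) ⁻¹' {t}) := by
  have h1 : (fun ω => supp (f ω)) ⁻¹' {t} = ⋂ j, {ω | f ω j ≠ 0 ↔ j ∈ t} := by
    ext ω
    simp [supp, Finset.ext_iff]
  rw [h1]
  refine MeasurableSet.iInter fun j => ?_
  have h2 : MeasurableSet {ω | f ω j = 0} := (measurable_pi_iff.1 hf j) (measurableSet_singleton 0)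
  by_cases hj : j ∈ t
  · simp only [hj, iff_true]
    exact h2.compl
  · simp only [hj, iff_false, not_not]
    exact h2

/-- Rates for a linear estimator after selection, from bounds on the probability of a wrong
selection, on all the linear maps, and on the linear map attached to the true support. -/
theorem hasRates_of_select {σ Λ c₂ : ℝ} (hσ : 0 < σ) (hΛ : 0 < Λ) (hc₂ : 0 < c₂)
    (hs : ∀ᶠ n in atTop, 0 < (supp (βs n).ofLp).card)
    (hind : ∀ᶠ n in atTop, iIndepFun (ε n) (P n))
    (hlaw : ∀ᶠ n in atTop, ∀ i, HasLaw (ε n i) (gaussianReal 0 (σ ^ 2).toNNReal) (P n))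
    {T : ∀ n, Ω n → Finset (Fin (p n))} (hT : ∀ᶠ n in atTop, ∀ t, MeasurableSet (T n ⁻¹' {t}))
    {A : ∀ n, Finset (Fin (p n)) → Matrix (Fin (p n)) (Fin n) ℝ} {B Q δ : ℕ → ℝ}
    (hQ : ∀ n, 0 < Q n)
    (hPQ : ∀ᶠ n in atTop, (P n).real {ω | T n ω ≠ supp (βs n).ofLp} ≤ Q n)
    (hB : ∀ᶠ n in atTop, ∀ t, ∑ j, ∑ i, A n t j i ^ 2 ≤ B n)
    (hA : ∀ᶠ n : ℕ in atTop, ∑ j, ∑ i, A n (supp (βs n).ofLp) j i ^ 2 ≤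
      1 / n * ((supp (βs n).ofLp).card * (1 / Λ)))
    (hδ : ∀ᶠ n in atTop, ∑ j, ((A n (supp (βs n).ofLp) *ᵥ (X n *ᵥ (βs n).ofLp)) j - βs n j) ^ 2 ≤
      δ n)
    (hδo : δ =o[atTop] fun n : ℕ => Real.exp (-(n : ℝ) ^ c₂ / 2))
    (hRo : (fun n : ℕ => √(Q n) * (1 + 16 * B n ^ 2 *
        (8 * (∑ i, (X n *ᵥ (βs n).ofLp) i ^ 2) ^ 2 +
          8 * ((n : ℝ) ^ 2 * ∫ x, x ^ 4 ∂(gaussianReal 0 (σ ^ 2).toNNReal))))) =o[atTop]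
      fun n : ℕ => Real.exp (-(n : ℝ) ^ c₂ / 2))
    {bt : ∀ n, Ω n → EuclideanSpace ℝ (Fin (p n))}
    (hbt : ∀ᶠ n in atTop, ∀ ω, bt n ω = linEst (A n (T n ω)) (response (X n) (βs n) (ε n) ω)) :
    HasRates P βs bt c₂ σ Λ 3 := by
  set R : ℕ → ℝ := fun n : ℕ => √(Q n) * (1 + 16 * B n ^ 2 *
        (8 * (∑ i, (X n *ᵥ (βs n).ofLp) i ^ 2) ^ 2 +
          8 * ((n : ℝ) ^ 2 * ∫ x, x ^ 4 ∂(gaussianReal 0 (σ ^ 2).toNNReal)))) with hR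
  have hmom : ∀ᶠ n in atTop, ‖(∫ ω, bt n ω ∂(P n)) - βs n‖ ^ 2 ≤ 2 * δ n + 2 * R n ∧
      ∫ ω, ‖bt n ω - βs n‖ ^ 2 ∂(P n) ≤ 2 * (δ n + (σ ^ 2).toNNReal *
        (1 / n * ((supp (βs n).ofLp).card * (1 / Λ)))) + 2 * R n := by
    filter_upwards [hind, hlaw, hT, hPQ, hB, hA, hδ, hbt] with n h1 h2 h3 h4 h5 h6 h7 h8
    have := integral_select_sub_sq_le (X := X n) (β := βs n) h2 h3 (hQ n) h5 h4
    simp only [h8]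
    exact select_moments h1 h2 h3 this h7 h6
  have hsum : (fun n => 2 * δ n + 2 * R n) =o[atTop]
      fun n : ℕ => Real.exp (-(n : ℝ) ^ c₂ / 2) :=
    (hδo.const_mul_left 2).add (hRo.const_mul_left 2)
  have hbias : (fun n : ℕ => ‖(∫ ω, bt n ω ∂(P n)) - βs n‖ ^ 2)
      =o[atTop] (fun n : ℕ => Real.exp (-(n : ℝ) ^ c₂ / 2)) := by
    refine IsBigO.trans_isLittleO (IsBigO.of_bound 1 ?_) hsum
    filter_upwards [hmom] with n hn
    rw [one_mul, Real.norm_of_nonneg (sq_nonneg _)]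
    exact hn.1.trans (le_abs_self _)
  have hexp : Tendsto (fun n : ℕ => Real.exp (-(n : ℝ) ^ c₂ / 2)) atTop (𝓝 0) := by
    refine (tendsto_rpow_mul_exp_neg_rpow 0 (half_pos one_pos) hc₂).congr fun n => ?_
    rw [Real.rpow_zero, one_mul]
    congr 1
    ring
  refine ⟨?_, hbias, hbias.isBigO.trans_tendsto hexp, ?_⟩
  · filter_upwards [hlaw, hT, hbt] with n h2 h3 h8
    have h : bt n = fun ω => linEst (A n (T n ω)) (response (X n) (βs n) (ε n) ω) := funext h8
    rw [h]
    exact memLp_select h2 h3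
  · have hsmall := (hsum.trans (exp_neg_rpow_isLittleO hc₂)).bound
      (show 0 < σ ^ 2 / Λ by positivity)
    filter_upwards [hmom, hsmall, hs] with n h1 h2 h3
    refine h1.2.trans ?_
    rw [Real.coe_toNNReal _ (sq_nonneg σ)]
    have h4 : 2 * δ n + 2 * R n ≤ σ ^ 2 / Λ * (1 / n) := by
      refine (le_abs_self _).trans ?_
      rwa [Real.norm_eq_abs, Real.norm_of_nonneg (by positivity)] at h2
    have h5 : (1 : ℝ) ≤ (supp (βs n).ofLp).card := by exact_mod_cast h3
    have h6 : σ ^ 2 / Λ * (1 / n) ≤ σ ^ 2 / Λ * ((supp (βs n).ofLp).card / n) := by gcongr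
    have h7 : σ ^ 2 * (1 / (n : ℝ) * ((supp (βs n).ofLp).card * (1 / Λ))) =
      σ ^ 2 / Λ * ((supp (βs n).ofLp).card / n) := by ring
    rw [mul_add, h7]
    linarith

end Sequences

/-! ### Probability of a wrong selection at fixed `n`. -/

section SelectionProbability

open scoped NNReal

variable {Ω : Type*} [MeasurableSpace Ω] {P : Measure Ω} [IsProbabilityMeasure P] {n p : ℕ}
  {X : Matrix (Fin n) (Fin p) ℝ} {β : EuclideanSpace ℝ (Fin p)} {S : Finset (Fin p)}
  {e : Fin n → Ω → ℝ} {v : ℝ≥0}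

/-- A coordinate is at most the Euclidean norm, and the sign vector has norm at most `√|S|`. This
root is what brings `c₁` into the upper limit for `c₄`. -/
theorem abs_inv_mulVec_sign_le {Λ : ℝ} (hΛ : 0 < Λ)
    (h : ∀ v : {j // j ∈ S} → ℝ, Λ * ∑ a, v a ^ 2 ≤ v ⬝ᵥ (C11 X S *ᵥ v)) (b : Fin p → ℝ)
    (j : {j // j ∈ S}) :
    |((C11 X S)⁻¹ *ᵥ fun k : {k // k ∈ S} => Real.sign (b k)) j| ≤ √(S.card : ℝ) / Λ := by
  set sg : {k // k ∈ S} → ℝ := fun k => Real.sign (b k)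
  have h1 := sum_sq_inv_mulVec_le hΛ h sg
  have h2 : ((C11 X S)⁻¹ *ᵥ sg) j ^ 2 ≤ ∑ a, ((C11 X S)⁻¹ *ᵥ sg) a ^ 2 :=
    Finset.single_le_sum (f := fun a => ((C11 X S)⁻¹ *ᵥ sg) a ^ 2)
      (fun a _ => sq_nonneg _) (Finset.mem_univ j)
  have h3 : ∑ a, sg a ^ 2 ≤ S.card := by
    calc ∑ a, sg a ^ 2 ≤ ∑ a : {k // k ∈ S}, (1 : ℝ) := by
          refine Finset.sum_le_sum fun a _ => ?_
          rcases Real.sign_apply_eq (b a) with h | h | h <;> simp [sg, h]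
      _ = S.card := by simp
  rw [le_div_iff₀ hΛ]
  refine Real.le_sqrt_of_sq_le ?_
  rw [mul_pow, sq_abs]
  have h4 := mul_le_mul_of_nonneg_left h2 (sq_nonneg Λ)
  linarith

/-- Probability that the Lasso selects a wrong set. -/
theorem measureReal_supp_lasso_ne_le (hn : 0 < n) {Λ : ℝ} (hΛ : 0 < Λ)
    (h : ∀ v : {j // j ∈ S} → ℝ, Λ * ∑ a, v a ^ 2 ≤ v ⬝ᵥ (C11 X S *ᵥ v))
    (hX : ∀ j, ∑ i, X i j ^ 2 ≤ n)
    {lam η t : ℝ} (hlam : 0 < lam) (hη : 0 < η) (ht : 0 ≤ t) (hS : S = supp β.ofLp)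
    (hIC : ∀ j : {j // j ∉ S}, |((C21 X S * (C11 X S)⁻¹) *ᵥ
      fun k : {k // k ∈ S} => Real.sign (β k)) j| ≤ 1 - η)
    (hβ : ∀ j ∈ S, t + lam / (2 * n) * (√(S.card : ℝ) / Λ) ≤ |β j|)
    (hind : iIndepFun e P) (hlaw : ∀ i, HasLaw (e i) (gaussianReal 0 v) P)
    {βhat : Ω → Fin p → ℝ} (hhat : ∀ ω, IsLasso X (response X β e ω) lam (βhat ω)) :
    P.real {ω | supp (βhat ω) ≠ S} ≤
      p * (2 * Real.exp (-t ^ 2 / (2 * (v * (1 / (n * Λ)))))) +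
      p * (2 * Real.exp (-(lam * η / 2) ^ 2 / (2 * (v * n)))) := by
  have hu := isUnit_of_coercive hΛ h
  have hL : (0 : ℝ) ≤ 1 / (n * Λ) := by positivity
  have b1 := measureReal_exists_linear_ge_le hind hlaw (κ := {j // j ∈ S})
    (a := fun j => olsMatrix X S j) (L := NNReal.mk (1 / (n * Λ)) hL)
    (fun j => sum_sq_olsMatrix_le hn hΛ h j) ht
  have b2 := measureReal_exists_linear_ge_le hind hlaw (κ := {j // j ∉ S})
    (a := fun j => X.col j - hatMatrix X S *ᵥ X.col j) (L := (n : ℝ≥0))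
    (fun j => by
      refine (sum_sq_sub_hatMatrix_le hn hu _).trans ?_
      simpa using hX j) (t := lam * η / 2) (by positivity)
  -- If every form stays below its threshold, noise below `t` plus the shrinkage bound stays below
  -- `|β j|`, and `supp_lasso_eq` applies.
  have hsub : {ω | supp (βhat ω) ≠ S} ⊆
      {ω | ∃ j : {j // j ∈ S}, t ≤ |olsMatrix X S j ⬝ᵥ fun i => e i ω|} ∪
      {ω | ∃ j : {j // j ∉ S}, lam * η / 2 ≤
        |(X.col j - hatMatrix X S *ᵥ X.col j) ⬝ᵥ fun i => e i ω|} := by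
    intro ω hω
    by_contra hcon
    rw [Set.mem_union, not_or] at hcon
    simp only [Set.mem_ofPred_eq, not_exists, not_le] at hcon
    refine hω (supp_lasso_eq hn hΛ h hlam (η := η) hS hIC (e := fun i => e i ω) (fun j => ?_)
      (fun j hj => hcon.2 ⟨j, hj⟩) (hhat ω))
    refine lt_of_lt_of_le ?_ (hβ j j.2)
    refine add_lt_add_of_lt_of_le (hcon.1 j) ?_
    exact mul_le_mul_of_nonneg_left (abs_inv_mulVec_sign_le hΛ h _ j) (by positivity)
  have c1 : (Fintype.card {j // j ∈ S} : ℝ) ≤ p := by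
    have := Fintype.card_subtype_le (fun j => j ∈ S)
    rw [Fintype.card_fin] at this
    exact_mod_cast this
  have c2 : (Fintype.card {j // j ∉ S} : ℝ) ≤ p := by
    have := Fintype.card_subtype_le (fun j => j ∉ S)
    rw [Fintype.card_fin] at this
    exact_mod_cast this
  refine (measureReal_mono hsub).trans ((measureReal_union_le _ _).trans (add_le_add ?_ ?_))
  · refine b1.trans ?_
    rw [NNReal.coe_mk]
    gcongr
  · refine b2.trans ?_
    simp only [NNReal.coe_natCast]
    gcongr

end SelectionProbability

/-! ### Exponential selection rate and rates for filters after the Lasso. -/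

section SelectionRate

variable {Ω : ℕ → Type*} [∀ n, MeasurableSpace (Ω n)] {P : ∀ n, Measure (Ω n)}
  [∀ n, IsProbabilityMeasure (P n)] {p : ℕ → ℕ} {X : ∀ n, Matrix (Fin n) (Fin (p n)) ℝ}
  {βs : ∀ n, EuclideanSpace ℝ (Fin (p n))} {S : ∀ n, Finset (Fin (p n))}
  {ε : ∀ n, Fin n → Ω n → ℝ} {lam : ℕ → ℝ}

/-- The threshold for the noise and the Lasso shrinkage stay below the smallest coefficient. -/
theorem eventually_shrinkage_le {Λ c₁ c₃ c₄ M : ℝ} (hΛ : 0 < Λ) (hM : 0 < M)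
    (hd_s : (fun n : ℕ => ((S n).card : ℝ)) =O[atTop] fun n : ℕ => (n : ℝ) ^ c₁)
    (hi : ∀ᶠ n : ℕ in atTop, ∀ j ∈ S n, M ≤ (n : ℝ) ^ ((1 - c₃) / 2) * |βs n j|)
    (hc₄ : c₄ < c₃ - c₁) (hj : SameOrder lam fun n : ℕ => (n : ℝ) ^ ((1 + c₄) / 2)) :
    ∀ᶠ n : ℕ in atTop, ∀ j ∈ S n, M / 2 * (n : ℝ) ^ ((c₃ - 1) / 2) +
      lam n / (2 * n) * (√((S n).card : ℝ) / Λ) ≤ |βs n j| := by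
  obtain ⟨C, hC, hCs⟩ := hd_s.exists_pos
  obtain ⟨k, K, hk, hK, hlam⟩ := hj
  -- The shrinkage `lam √s / n` is of smaller order than the minimal signal `n^((c₃-1)/2)` precisely
  -- because `c₄ < c₃ - c₁`; half the signal is reserved for noise.
  have hexp : (1 + c₄) / 2 - 1 + c₁ / 2 < (c₃ - 1) / 2 := by linarith
  filter_upwards [hi, hCs.bound, hlam, eventually_gt_atTop 0,
    eventually_mul_rpow_le hexp (K * √C / (2 * Λ)) (half_pos hM)] with n h1 h2 h3 hn h4 j hjS
  have hn' : (0 : ℝ) < n := by exact_mod_cast hn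
  have e1 : M * (n : ℝ) ^ ((c₃ - 1) / 2) ≤ |βs n j| := by
    have h5 : (n : ℝ) ^ ((1 - c₃) / 2) * (n : ℝ) ^ ((c₃ - 1) / 2) = 1 := by
      rw [← Real.rpow_add hn']
      rw [show (1 - c₃) / 2 + (c₃ - 1) / 2 = 0 by ring, Real.rpow_zero]
    have h6 := mul_le_mul_of_nonneg_right (h1 j hjS)
      (by positivity : 0 ≤ (n : ℝ) ^ ((c₃ - 1) / 2))
    calc _ ≤ _ := h6
      _ = (n : ℝ) ^ ((1 - c₃) / 2) * (n : ℝ) ^ ((c₃ - 1) / 2) * |βs n j| := by ring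
      _ = |βs n j| := by rw [h5, one_mul]
  have e2 : √((S n).card : ℝ) ≤ √C * (n : ℝ) ^ (c₁ / 2) := by
    rw [Real.norm_of_nonneg (by positivity), Real.norm_of_nonneg (by positivity)] at h2
    refine (Real.sqrt_le_sqrt h2).trans (le_of_eq ?_)
    rw [Real.sqrt_mul hC.le, Real.sqrt_eq_rpow ((n : ℝ) ^ c₁), ← Real.rpow_mul hn'.le]
    congr 2
    ring
  have e3 : lam n / (2 * n) * (√((S n).card : ℝ) / Λ) ≤
      K * √C / (2 * Λ) * (n : ℝ) ^ ((1 + c₄) / 2 - 1 + c₁ / 2) := by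
    calc lam n / (2 * n) * (√((S n).card : ℝ) / Λ)
        ≤ K * (n : ℝ) ^ ((1 + c₄) / 2) / (2 * n) * (√C * (n : ℝ) ^ (c₁ / 2) / Λ) := by
          gcongr
          exact h3.2
      _ = K * √C / (2 * Λ) * (n : ℝ) ^ ((1 + c₄) / 2 - 1 + c₁ / 2) := by
          rw [Real.rpow_add hn', Real.rpow_sub_one hn'.ne']
          field_simp
  linarith

/-- The Lasso selects the true support up to an exponentially small probability. -/
theorem exists_selection_rate {σ Λ c₁ c₂ c₃ c₄ M η : ℝ} (hσ : 0 < σ) (hΛ : 0 < Λ) (hM : 0 < M)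
    (hη : 0 < η) (hc₁ : 0 ≤ c₁) (hS : ∀ n, S n = supp (βs n).ofLp)
    (hind : ∀ᶠ n in atTop, iIndepFun (ε n) (P n))
    (hlaw : ∀ᶠ n in atTop, ∀ i, HasLaw (ε n i) (gaussianReal 0 (σ ^ 2).toNNReal) (P n))
    (hX : ∀ᶠ n : ℕ in atTop, ∀ j, ∑ i, X n i j ^ 2 ≤ n)
    (hco : ∀ᶠ n in atTop, ∀ v : {j // j ∈ S n} → ℝ,
      Λ * ∑ a, v a ^ 2 ≤ v ⬝ᵥ (C11 (X n) (S n) *ᵥ v))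
    (hd_s : (fun n : ℕ => ((S n).card : ℝ)) =O[atTop] fun n : ℕ => (n : ℝ) ^ c₁)
    (hd_p : (fun n : ℕ => (p n : ℝ)) =O[atTop] fun n : ℕ => Real.exp ((n : ℝ) ^ c₂))
    (hi : ∀ᶠ n : ℕ in atTop, ∀ j ∈ S n, M ≤ (n : ℝ) ^ ((1 - c₃) / 2) * |βs n j|)
    (hc₄ : c₄ < c₃ - c₁) (hj : SameOrder lam fun n : ℕ => (n : ℝ) ^ ((1 + c₄) / 2))
    (hIC : ∀ᶠ n in atTop, ∀ j : {j // j ∉ S n},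
      |((C21 (X n) (S n) * (C11 (X n) (S n))⁻¹) *ᵥ
        fun k : {k // k ∈ S n} => Real.sign (βs n k)) j| ≤ 1 - η)
    {βhat : ∀ n, Ω n → Fin (p n) → ℝ}
    (hhat : ∀ᶠ n in atTop, ∀ ω,
      IsLasso (X n) (response (X n) (βs n) (ε n) ω) (lam n) (βhat n ω)) :
    ∃ a κ : ℝ, 0 < a ∧ 0 < κ ∧ ∀ᶠ n : ℕ in atTop,
      (P n).real {ω | supp (βhat n ω) ≠ supp (βs n).ofLp} ≤
        a * Real.exp ((n : ℝ) ^ c₂ - κ * (n : ℝ) ^ c₄) := by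
  have hshr := eventually_shrinkage_le hΛ hM hd_s hi hc₄ hj
  obtain ⟨C, hC, hCp⟩ := hd_p.exists_pos
  obtain ⟨k, K, hk, hK, hlam⟩ := hj
  -- The two Gaussian exponents are `κ₁ n^c₃` on the support and at least `κ₂ n^c₄` off it. As `c₄ ≤
  -- c₃`, both dominate `min κ₁ κ₂ * n^c₄`.
  set κ₁ : ℝ := (M / 2) ^ 2 * Λ / (2 * σ ^ 2)
  set κ₂ : ℝ := (k * η / 2) ^ 2 / (2 * σ ^ 2)
  refine ⟨4 * C, min κ₁ κ₂, by positivity, by positivity, ?_⟩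
  filter_upwards [hind, hlaw, hX, hco, hshr, hIC, hhat, hCp.bound, hlam, eventually_ge_atTop 1]
    with n h1 h2 h3 h4 h5 h6 h7 h8 h9 hn
  have hn1 : (1 : ℝ) ≤ n := by exact_mod_cast hn
  have hn' : (0 : ℝ) < n := by linarith
  have hpos : 0 < lam n := lt_of_lt_of_le (by positivity) h9.1
  have key := measureReal_supp_lasso_ne_le hn hΛ h4 h3 hpos hη
    (t := M / 2 * (n : ℝ) ^ ((c₃ - 1) / 2)) (by positivity) (hS n) h6 h5 h1 h2 h7
  rw [← hS n]
  refine key.trans ?_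
  rw [Real.coe_toNNReal _ (sq_nonneg σ)]
  have hsq : ∀ r : ℝ, ((n : ℝ) ^ (r / 2)) ^ 2 = (n : ℝ) ^ r := by
    intro r
    rw [← Real.rpow_natCast, ← Real.rpow_mul hn'.le]
    congr 1
    push_cast
    ring
  have e1 : min κ₁ κ₂ * (n : ℝ) ^ c₄ ≤
      (M / 2 * (n : ℝ) ^ ((c₃ - 1) / 2)) ^ 2 / (2 * (σ ^ 2 * (1 / (n * Λ)))) := by
    calc min κ₁ κ₂ * (n : ℝ) ^ c₄ ≤ κ₁ * (n : ℝ) ^ c₃ := by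
          gcongr
          · exact min_le_left _ _
          linarith
      _ = _ := by
          rw [mul_pow, hsq, Real.rpow_sub_one hn'.ne']
          simp only [κ₁]
          field_simp
  have e2 : min κ₁ κ₂ * (n : ℝ) ^ c₄ ≤ (lam n * η / 2) ^ 2 / (2 * (σ ^ 2 * n)) := by
    calc min κ₁ κ₂ * (n : ℝ) ^ c₄ ≤ κ₂ * (n : ℝ) ^ c₄ := by
          gcongr
          exact min_le_right _ _
      _ = (k * (n : ℝ) ^ ((1 + c₄) / 2) * η / 2) ^ 2 / (2 * (σ ^ 2 * n)) := by
          have : (k * (n : ℝ) ^ ((1 + c₄) / 2) * η / 2) ^ 2 =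
              (k * η / 2) ^ 2 * ((n : ℝ) ^ ((1 + c₄) / 2)) ^ 2 := by ring
          rw [this, hsq, Real.rpow_add hn', Real.rpow_one]
          simp only [κ₂]
          field_simp
      _ ≤ _ := by
          gcongr
          exact h9.1
  rw [Real.norm_of_nonneg (by positivity), Real.norm_of_nonneg (by positivity)] at h8
  rw [neg_div, neg_div]
  calc (p n : ℝ) * (2 * Real.exp _) + p n * (2 * Real.exp _)
      ≤ C * Real.exp ((n : ℝ) ^ c₂) * (2 * Real.exp (-(min κ₁ κ₂ * (n : ℝ) ^ c₄))) +
        C * Real.exp ((n : ℝ) ^ c₂) * (2 * Real.exp (-(min κ₁ κ₂ * (n : ℝ) ^ c₄))) := by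
        gcongr
    _ = _ := by rw [sub_eq_add_neg, Real.exp_add]; ring

/-- Rates for spectral filters applied to the columns selected by the Lasso. -/
theorem hasRates_filter {σ Λ c₂ c₄ a κ C : ℝ} (hσ : 0 < σ) (hΛ : 0 < Λ) (hc₂ : 0 < c₂)
    (hc₄ : c₂ < c₄) (ha : 0 < a) (hκ : 0 < κ) (hS : ∀ n, S n = supp (βs n).ofLp)
    (hs : ∀ᶠ n in atTop, 0 < (S n).card)
    (hind : ∀ᶠ n in atTop, iIndepFun (ε n) (P n))
    (hlaw : ∀ᶠ n in atTop, ∀ i, HasLaw (ε n i) (gaussianReal 0 (σ ^ 2).toNNReal) (P n))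
    (hco : ∀ᶠ n in atTop, ∀ v : {j // j ∈ S n} → ℝ,
      Λ * ∑ a, v a ^ 2 ≤ v ⬝ᵥ (C11 (X n) (S n) *ᵥ v))
    (hd_p : (fun n : ℕ => (p n : ℝ)) =O[atTop] fun n : ℕ => Real.exp ((n : ℝ) ^ c₂))
    (hg : (fun n : ℕ => (1 / (n : ℝ)) * ∑ i, (X n *ᵥ (βs n).ofLp) i ^ 2)
      =O[atTop] fun n : ℕ => (n : ℝ))
    {βhat : ∀ n, Ω n → Fin (p n) → ℝ} (hmeas : ∀ᶠ n in atTop, Measurable (βhat n))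
    (hsel : ∀ᶠ n : ℕ in atTop, (P n).real {ω | supp (βhat n ω) ≠ supp (βs n).ofLp} ≤
        a * Real.exp ((n : ℝ) ^ c₂ - κ * (n : ℝ) ^ c₄))
    (W : ∀ n (T : Finset (Fin (p n))), SVD ((1 / √(n : ℝ)) • cols (X n) T))
    {g : ℕ → ℝ → ℝ} {r : ℕ → ℝ}
    (hgC : ∀ᶠ n : ℕ in atTop, ∀ d, 0 ≤ d →
      g n d ^ 2 ≤ C * ((n : ℝ) ^ 2 * Real.exp ((n : ℝ) ^ c₂)))
    (hgΛ : ∀ᶠ n in atTop, ∀ d, 0 ≤ d → Λ ≤ d ^ 2 → g n d ^ 2 ≤ 1 / Λ)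
    (hgr : ∀ᶠ n in atTop, ∀ d, 0 ≤ d → Λ ≤ d ^ 2 → (1 - g n d * d) ^ 2 ≤ r n)
    (hr : (fun n => r n * ∑ j, βs n j ^ 2) =o[atTop] fun n : ℕ => Real.exp (-(n : ℝ) ^ c₂ / 2))
    {bt : ∀ n, Ω n → EuclideanSpace ℝ (Fin (p n))}
    (hbt : ∀ᶠ n in atTop, ∀ ω, bt n ω =
      linEst (filterMatrix (X n) (supp (βhat n ω)) (W n (supp (βhat n ω))) (g n))
        (response (X n) (βs n) (ε n) ω)) :
    HasRates P βs bt c₂ σ Λ 3 := by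
  obtain ⟨D, hD, hDp⟩ := hd_p.exists_pos
  obtain ⟨u, hu, hug⟩ := hg.exists_pos
  have hV : ∀ᶠ n : ℕ in atTop, ∑ i, (X n *ᵥ (βs n).ofLp) i ^ 2 ≤ u * (n : ℝ) ^ 2 := by
    filter_upwards [hug.bound, eventually_gt_atTop 0] with n hn hn0
    have hn' : (0 : ℝ) < n := by exact_mod_cast hn0
    rw [Real.norm_of_nonneg (by positivity), Real.norm_of_nonneg (by positivity),
      one_div_mul_eq_div, div_le_iff₀ hn'] at hn
    linarith
  have hRo := selection_error_isLittleO (b := D * C) hκ hc₄ hc₂ ha.le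
    (V := fun n => ∑ i, (X n *ᵥ (βs n).ofLp) i ^ 2)
    (w := ∫ x, x ^ 4 ∂(gaussianReal 0 (σ ^ 2).toNNReal))
    (integral_nonneg fun x => by positivity)
    (fun n => Finset.sum_nonneg fun i _ => sq_nonneg _) hV
  refine hasRates_of_select (T := fun n ω => supp (βhat n ω))
    (A := fun n T => filterMatrix (X n) T (W n T) (g n)) hσ hΛ hc₂ (by simpa only [hS] using hs)
    hind hlaw ?_ (fun n => by positivity) hsel ?_ ?_ ?_ hr hRo hbt
  · filter_upwards [hmeas] with n hn
    exact measurableSet_supp_preimage hn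
  · filter_upwards [hgC, hDp.bound, eventually_ge_atTop 1] with n h1 h2 hn t
    have hn1 : (1 : ℝ) ≤ n := by exact_mod_cast hn
    rw [Real.norm_of_nonneg (by positivity), Real.norm_of_nonneg (by positivity)] at h2
    have h3 : (t.card : ℝ) ≤ p n := by
      have := Finset.card_le_univ t
      rw [Fintype.card_fin] at this
      exact_mod_cast this
    have h4 : 0 ≤ C * ((n : ℝ) ^ 2 * Real.exp ((n : ℝ) ^ c₂)) :=
      -- No sign is assumed for `C`; the bound at `d = 0` already forces the right side to be
      -- nonnegative.
      (sq_nonneg _).trans (h1 0 le_rfl)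
    refine (sum_sq_filterMatrix_le _ _ fun k => h1 _ ((W n t).sv_nonneg k)).trans ?_
    -- One factor `exp(n^c₂)` bounds the number of columns, the other the squared filter.
    calc 1 / (n : ℝ) * (t.card * (C * ((n : ℝ) ^ 2 * Real.exp ((n : ℝ) ^ c₂))))
        ≤ 1 * (D * Real.exp ((n : ℝ) ^ c₂) * (C * ((n : ℝ) ^ 2 * Real.exp ((n : ℝ) ^ c₂)))) := by
          gcongr
          · rw [div_le_one (by linarith)]; exact hn1
          · exact h3.trans h2
      _ = D * C * (n : ℝ) ^ 2 * Real.exp (2 * (n : ℝ) ^ c₂) := by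
          rw [two_mul, Real.exp_add]; ring
  · filter_upwards [hgΛ, hco] with n h1 h2
    rw [← hS n]
    refine sum_sq_filterMatrix_le _ _ fun k => h1 _ ((W n (S n)).sv_nonneg k) ?_
    rw [C11_eq] at h2
    exact ((W n (S n)).le_sv_sq hΛ h2 k).2
  · filter_upwards [hgr, hco, eventually_gt_atTop 0] with n h1 h2 hn
    rw [← hS n]
    refine sum_sq_filterMatrix_sub_le hn _ hΛ h2 _ h1 fun j hj => ?_
    rw [hS n] at hj
    simpa [supp] using hj

end SelectionRate

/-! ### Bounds for the two concrete filters and the Ridge bias. -/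

section Filters

theorem thresholdInv_sq_le {τ : ℝ} (hτ : 0 < τ) (d : ℝ) : thresholdInv τ d ^ 2 ≤ 1 / τ ^ 2 := by
  rw [thresholdInv]
  split_ifs with h
  · rw [zero_pow two_ne_zero]; positivity
  · rw [inv_pow, ← one_div]
    have := not_lt.1 h
    gcongr

/-- Once the threshold is below `√Λ` it is inactive on the true support, where mLS becomes ordinary
least squares and has no bias. -/
theorem thresholdInv_eq_inv {τ Λ d : ℝ} (hτ : τ ≤ √Λ) (hd : 0 ≤ d)
    (h : Λ ≤ d ^ 2) : thresholdInv τ d = d⁻¹ := by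
  have h1 : √Λ ≤ d := by
    rw [← Real.sqrt_sq hd]; exact Real.sqrt_le_sqrt h
  rw [thresholdInv, if_neg (by linarith)]

/-- Meant for arbitrary selected sets, where singular values may be as small as zero. -/
theorem ridge_filter_sq_le {ν : ℝ} (hν : 0 < ν) (d : ℝ) : (d / (d ^ 2 + ν)) ^ 2 ≤ 1 / ν := by
  rw [div_pow, div_le_div_iff₀ (by positivity) hν]
  nlinarith [sq_nonneg d, sq_nonneg (d ^ 2), sq_nonneg ν, mul_nonneg (sq_nonneg d) hν.le]

theorem ridge_filter_sq_le_of_le {ν Λ d : ℝ} (hν : 0 < ν) (hΛ : 0 < Λ) (h : Λ ≤ d ^ 2) :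
    (d / (d ^ 2 + ν)) ^ 2 ≤ 1 / Λ := by
  rw [div_pow, div_le_div_iff₀ (by positivity) hΛ]
  nlinarith [sq_nonneg d, mul_nonneg (sq_nonneg d) hν.le, mul_nonneg (sq_nonneg d) (sub_nonneg.2 h),
    sq_nonneg ν]

theorem one_sub_ridge_filter_sq_le {ν Λ d : ℝ} (hν : 0 < ν) (hΛ : 0 < Λ) (h : Λ ≤ d ^ 2) :
    (1 - d / (d ^ 2 + ν) * d) ^ 2 ≤ (ν / Λ) ^ 2 := by
  have h1 : 1 - d / (d ^ 2 + ν) * d = ν / (d ^ 2 + ν) := by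
    have : d ^ 2 + ν ≠ 0 := by positivity
    field_simp
    ring
  rw [h1]
  gcongr
  linarith

/-- Coercivity applied to the coefficients themselves; it converts the bound on the signal `X β*`
into `‖β*‖² = O(n)`. -/
theorem sum_sq_coeff_le {n p : ℕ} {X : Matrix (Fin n) (Fin p) ℝ} {S : Finset (Fin p)} {Λ : ℝ}
    (h : ∀ v : {j // j ∈ S} → ℝ, Λ * ∑ a, v a ^ 2 ≤ v ⬝ᵥ (C11 X S *ᵥ v)) {b : Fin p → ℝ}
    (hb : ∀ j, j ∉ S → b j = 0) : Λ * ∑ j, b j ^ 2 ≤ 1 / n * ∑ i, (X *ᵥ b) i ^ 2 := by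
  have h1 := h fun j => b j
  rw [C11, Matrix.smul_mulVec, dotProduct_smul, ← Matrix.mulVec_mulVec, cols_mulVec hb,
    Matrix.dotProduct_mulVec, Matrix.vecMul_transpose, cols_mulVec hb] at h1
  rw [sum_eq_sum_subtype (T := S) fun j => b j ^ 2]
  · simpa [dotProduct, sq] using h1
  · intro j hj; simp [hb j hj]

theorem tendsto_inv_natCast_mul (K : ℝ) : Tendsto (fun n : ℕ => K * (1 / (n : ℝ))) atTop (𝓝 0) := by
  simpa using (tendsto_one_div_atTop_nhds_zero_nat (𝕜 := ℝ)).const_mul K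

/-- Here `μ²` already has the order `exp(-n^c / 2)`. The remaining factor `‖β*‖² / n²` is `O(1/n)`,
which upgrades this to a little-o. -/
theorem ridge_bias_isLittleO {p : ℕ → ℕ} {X : ∀ n, Matrix (Fin n) (Fin (p n)) ℝ}
    {βs : ∀ n, EuclideanSpace ℝ (Fin (p n))} {S : ∀ n, Finset (Fin (p n))} {Λ c : ℝ} {μ : ℕ → ℝ}
    (hΛ : 0 < Λ) (hS : ∀ n, S n = supp (βs n).ofLp)
    (hco : ∀ᶠ n in atTop, ∀ v : {j // j ∈ S n} → ℝ,
      Λ * ∑ a, v a ^ 2 ≤ v ⬝ᵥ (C11 (X n) (S n) *ᵥ v))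
    (hg : (fun n : ℕ => (1 / (n : ℝ)) * ∑ i, (X n *ᵥ (βs n).ofLp) i ^ 2)
      =O[atTop] fun n : ℕ => (n : ℝ))
    (hμ : SameOrder μ fun n : ℕ => Real.exp (-(n : ℝ) ^ c / 4)) :
    (fun n => (μ n / n / Λ) ^ 2 * ∑ j, βs n j ^ 2) =o[atTop]
      fun n : ℕ => Real.exp (-(n : ℝ) ^ c / 2) := by
  obtain ⟨u, hu, hug⟩ := hg.exists_pos
  obtain ⟨k, K, hk, hK, hμ⟩ := hμ
  rw [isLittleO_iff_tendsto fun n h => absurd h (Real.exp_pos _).ne']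
  refine tendsto_of_tendsto_of_tendsto_of_le_of_le' tendsto_const_nhds
    (tendsto_inv_natCast_mul (K ^ 2 * u / Λ ^ 3)) (Eventually.of_forall fun n => by positivity) ?_
  filter_upwards [hug.bound, hμ, hco, eventually_gt_atTop 0] with n h1 h2 h3 hn
  have hn' : (0 : ℝ) < n := by exact_mod_cast hn
  rw [Real.norm_of_nonneg (by positivity), Real.norm_of_nonneg (by positivity)] at h1
  have hμ0 : 0 < μ n := lt_of_lt_of_le (by positivity) h2.1
  have h4 : Λ * ∑ j, βs n j ^ 2 ≤ u * n := by
    refine (sum_sq_coeff_le h3 fun j hj => ?_).trans h1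
    rw [hS n] at hj
    simpa [supp] using hj
  have h5 : ∑ j, βs n j ^ 2 ≤ u * n / Λ := by rwa [le_div_iff₀ hΛ, mul_comm]
  have h6 : μ n ^ 2 ≤ K ^ 2 * Real.exp (-(n : ℝ) ^ c / 2) := by
    calc μ n ^ 2 ≤ (K * Real.exp (-(n : ℝ) ^ c / 4)) ^ 2 := pow_le_pow_left₀ hμ0.le h2.2 2
      _ = _ := by
        rw [mul_pow, ← Real.exp_nat_mul]
        congr 2
        push_cast
        ring
  rw [div_le_iff₀ (Real.exp_pos _)]
  calc (μ n / n / Λ) ^ 2 * ∑ j, βs n j ^ 2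
      = μ n ^ 2 / (n ^ 2 * Λ ^ 2) * ∑ j, βs n j ^ 2 := by rw [div_div, div_pow, mul_pow]
    _ ≤ K ^ 2 * Real.exp (-(n : ℝ) ^ c / 2) / (n ^ 2 * Λ ^ 2) * (u * n / Λ) := by gcongr
    _ = _ := by field_simp

end Filters

end PostLasso

end

/-! ### The main theorem. -/

open PostLasso in
theorem corollary1 :
    ∃ K : ℝ, 0 < K ∧
    ∀ (Ω : ℕ → Type*) [∀ n, MeasurableSpace (Ω n)]
      (P : ∀ n, Measure (Ω n)) [∀ n, IsProbabilityMeasure (P n)]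
      (p : ℕ → ℕ) (X : ∀ n, Matrix (Fin n) (Fin (p n)) ℝ)
      (βs : ∀ n, EuclideanSpace ℝ (Fin (p n)))
      (S : ∀ n, Finset (Fin (p n))) (_hS : ∀ n, S n = supp (βs n).ofLp)
      (_hs : ∀ᶠ n in atTop, 0 < (S n).card)
      (ε : ∀ n, Fin n → Ω n → ℝ)
      (σ Λ c₁ c₂ c₃ c₄ M η : ℝ) (lam τ μ : ℕ → ℝ)
      -- (a): i.i.d. Gaussian errors
      (_hσ : 0 < σ)
      (_ha_indep : ∀ᶠ n in atTop, iIndepFun (ε n) (P n))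
      (_ha_law : ∀ᶠ n in atTop, ∀ i, HasLaw (ε n i) (gaussianReal 0 (σ ^ 2).toNNReal) (P n))
      -- (b): standardized predictors
      (_hb : ∀ᶠ n : ℕ in atTop, ∀ j,
        (1 / (n : ℝ)) * ∑ i, X n i j = 0 ∧ (1 / (n : ℝ)) * ∑ i, X n i j ^ 2 = 1)
      -- (c): all eigenvalues of `C₁₁` are at least `Λ`
      (_hΛ : 0 < Λ)
      (_hc : ∀ᶠ n in atTop, ∀ t ∈ spectrum ℝ (C11 (X n) (S n)), Λ ≤ t)
      -- (d): sparsity and dimension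
      (_hc₁ : 0 ≤ c₁ ∧ c₁ < 1) (_hc₂ : 0 < c₂ ∧ c₂ < 1 - c₁)
      (_hd_s : (fun n : ℕ => ((S n).card : ℝ)) =O[atTop] fun n : ℕ => (n : ℝ) ^ c₁)
      (_hd_p : (fun n : ℕ => (p n : ℝ)) =O[atTop] fun n : ℕ => Real.exp ((n : ℝ) ^ c₂))
      -- (g): size of the signal
      (_hg : (fun n : ℕ => (1 / (n : ℝ)) * ∑ i, (X n *ᵥ (βs n).ofLp) i ^ 2)
        =O[atTop] fun n : ℕ => (n : ℝ))
      -- (i): lower bound on the nonzero coefficients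
      (_hc₃ : c₁ + c₂ < c₃ ∧ c₃ ≤ 1) (_hM : 0 < M)
      (_hi : ∀ᶠ n : ℕ in atTop, ∀ j ∈ S n, M ≤ (n : ℝ) ^ ((1 - c₃) / 2) * |βs n j|)
      -- (j): Lasso tuning parameter
      (_hc₄ : c₂ < c₄ ∧ c₄ < c₃ - c₁)
      (_hj : SameOrder lam fun n : ℕ => (n : ℝ) ^ ((1 + c₄) / 2))
      -- Irrepresentable condition
      (_hη : 0 < η)
      (_hIC : ∀ᶠ n in atTop, ∀ j : {j // j ∉ S n},
        |((C21 (X n) (S n) * (C11 (X n) (S n))⁻¹) *ᵥ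
          fun k : {k // k ∈ S n} => Real.sign (βs n k)) j| ≤ 1 - η)
      -- second stage tuning parameters
      (_hτ : SameOrder τ fun n : ℕ => 1 / (n : ℝ))
      (_hμ : SameOrder μ fun n : ℕ => Real.exp (-(n : ℝ) ^ c₂ / 4))
      -- a measurable Lasso estimator
      (βhat : ∀ n, Ω n → Fin (p n) → ℝ)
      (_hhat_meas : ∀ᶠ n in atTop, Measurable (βhat n))
      (_hhat : ∀ᶠ n in atTop, ∀ ω, IsLasso (X n) (response (X n) (βs n) (ε n) ω) (lam n) (βhat n ω))
      -- the singular value decompositions used by Lasso+mLS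
      (W : ∀ n (T : Finset (Fin (p n))), SVD ((1 / √(n : ℝ)) • cols (X n) T))
      -- the Lasso+Ridge estimator
      (βridge : ∀ n, Ω n → EuclideanSpace ℝ (Fin (p n)))
      (_hridge : ∀ᶠ n in atTop, ∀ ω, IsSelectRidge (X n) (response (X n) (βs n) (ε n) ω) (μ n)
        (supp (βhat n ω)) (βridge n ω).ofLp),
      HasRates P βs
        (fun n ω => selectMLS (X n) (supp (βhat n ω)) (W n (supp (βhat n ω))) (τ n)
          (response (X n) (βs n) (ε n) ω)) c₂ σ Λ K ∧
      HasRates P βs βridge c₂ σ Λ K := by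
  refine ⟨3, by norm_num, ?_⟩
  intro Ω _ P _ p X βs S hS hs ε σ Λ c₁ c₂ c₃ c₄ M η lam τ μ hσ hind hlaw hb hΛ hc hc₁ hc₂ hd_s
    hd_p hg hc₃ hM hi hc₄ hj hη hIC hτ hμ βhat hmeas hhat W βridge hridge
  have hX : ∀ᶠ n : ℕ in atTop, ∀ j, ∑ i, X n i j ^ 2 ≤ n := by
    filter_upwards [hb, eventually_gt_atTop 0] with n h hn j
    have hn' : (0 : ℝ) < n := by exact_mod_cast hn
    have := (h j).2
    rw [one_div_mul_eq_div, div_eq_iff hn'.ne', one_mul] at this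
    exact this.le
  have hco : ∀ᶠ n in atTop, ∀ v : {j // j ∈ S n} → ℝ,
      Λ * ∑ a, v a ^ 2 ≤ v ⬝ᵥ (C11 (X n) (S n) *ᵥ v) := by
    filter_upwards [hc] with n h
    exact coercive_of_spectrum C11_isHermitian h
  obtain ⟨a, κ, ha, hκ, hsel⟩ := exists_selection_rate hσ hΛ hM hη hc₁.1 hS hind hlaw hX hco hd_s
    hd_p hi hc₄.2 hj hIC hhat
  obtain ⟨k, K, hk, hK, hτ⟩ := hτ
  have hμ' := hμ
  obtain ⟨k', K', hk', hK', hμ'⟩ := hμ'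
  have hτsmall : ∀ᶠ n in atTop, τ n ≤ √Λ := by
    filter_upwards [hτ, (tendsto_inv_natCast_mul K).eventually_le_const (Real.sqrt_pos.2 hΛ)]
      with n h1 h2
    exact h1.2.trans h2
  have hmLS : ∀ᶠ n in atTop, ∀ d, 0 ≤ d → Λ ≤ d ^ 2 →
      0 < d ∧ thresholdInv (τ n) d = d⁻¹ := by
    filter_upwards [hτsmall] with n h1 d hd h
    refine ⟨lt_of_le_of_ne hd fun h0 => ?_, thresholdInv_eq_inv h1 hd h⟩
    rw [← h0] at h
    linarith [zero_pow (M₀ := ℝ) two_ne_zero]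
  have hμpos : ∀ᶠ n in atTop, 0 < μ n := by
    filter_upwards [hμ'] with n h
    exact lt_of_lt_of_le (by positivity) h.1
  constructor
  -- From `τ ≥ k / n` the squared filter is at most `n² / k²`; `r = 0` since the filter exactly
  -- inverts singular values above the threshold.
  · refine hasRates_filter (C := 1 / k ^ 2) (r := 0) hσ hΛ hc₂.1 hc₄.1 ha hκ hS hs hind hlaw hco
      hd_p hg hmeas hsel W (g := fun n => thresholdInv (τ n)) ?_ ?_ ?_ (by simp) ?_
    · filter_upwards [hτ, eventually_gt_atTop 0] with n h1 hn d _
      have hn' : (0 : ℝ) < n := by exact_mod_cast hn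
      have h2 : 0 < k * (1 / (n : ℝ)) := by positivity
      calc thresholdInv (τ n) d ^ 2 ≤ 1 / τ n ^ 2 := thresholdInv_sq_le (h2.trans_le h1.1) d
        _ ≤ 1 / (k * (1 / (n : ℝ))) ^ 2 := by
            gcongr
            exact h1.1
        _ = 1 / k ^ 2 * ((n : ℝ) ^ 2 * 1) := by field_simp
        _ ≤ _ := by
            gcongr
            exact Real.one_le_exp (by positivity)
    · filter_upwards [hmLS] with n h1 d hd h
      obtain ⟨_, h2⟩ := h1 d hd h
      rw [h2, inv_pow, ← one_div]
      gcongr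
    · filter_upwards [hmLS] with n h1 d hd h
      obtain ⟨h0, h2⟩ := h1 d hd h
      rw [h2, inv_mul_cancel₀ h0.ne']
      simp
    · exact Eventually.of_forall fun n ω => selectMLS_eq _ _ _
  -- With `ν = μ / n`, the squared filter is at most `n / μ ≤ (n / k') exp(n^c₂ / 4)`, and the
  -- relative bias `ν / (d² + ν)` is at most `ν / Λ`.
  · refine hasRates_filter (C := 1 / k') (r := fun n => (μ n / n / Λ) ^ 2) hσ hΛ hc₂.1 hc₄.1 ha
      hκ hS hs hind hlaw hco hd_p hg hmeas hsel W (g := fun n d => d / (d ^ 2 + μ n / n))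
      ?_ ?_ ?_ (ridge_bias_isLittleO hΛ hS hco hg hμ) ?_
    · filter_upwards [hμ', hμpos, eventually_ge_atTop 1] with n h1 h2 hn d _
      have hn1 : (1 : ℝ) ≤ n := by exact_mod_cast hn
      have hn' : (0 : ℝ) < n := by linarith
      calc (d / (d ^ 2 + μ n / n)) ^ 2 ≤ 1 / (μ n / n) := ridge_filter_sq_le (by positivity) d
        _ ≤ 1 / (k' * Real.exp (-(n : ℝ) ^ c₂ / 4) / n) := by
            gcongr
            exact h1.1
        _ = 1 / k' * ((n : ℝ) * Real.exp ((n : ℝ) ^ c₂ / 4)) := by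
            rw [neg_div, Real.exp_neg]
            field_simp
        _ ≤ 1 / k' * ((n : ℝ) ^ 2 * Real.exp ((n : ℝ) ^ c₂)) := by
            have : 0 ≤ (n : ℝ) ^ c₂ := by positivity
            gcongr
            · exact le_self_pow₀ hn1 two_ne_zero
            · linarith
    · filter_upwards [hμpos, eventually_gt_atTop 0] with n h1 hn d _ h
      have hn' : (0 : ℝ) < n := by exact_mod_cast hn
      exact ridge_filter_sq_le_of_le (by positivity) hΛ h
    · filter_upwards [hμpos, eventually_gt_atTop 0] with n h1 hn d _ h
      have hn' : (0 : ℝ) < n := by exact_mod_cast hn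
      exact one_sub_ridge_filter_sq_le (by positivity) hΛ h
    · filter_upwards [hridge, hμpos, eventually_gt_atTop 0] with n h1 h2 hn ω
      have h3 := selectRidge_eq hn (W n (supp (βhat n ω))) h2 (h1 ω)
      ext j
      exact congrFun h3 j
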